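/- **Model.** $n$ base objects support atomic read-modify-write (RMW) access by a finite set $\Pi$ of deterministic asynchronous clients; $f<n/2$. In a run, at most $f$ base objects and any number of clients may crash. Clients execute high-level reads and writes (one at a time each) on an emulated multi-writer multi-reader (MWMR) register with values in a finite set $\mathbb V$ and initial value $v_0\in\mathbb V$; in the course of an operation a client triggers RMWs on base objects. An RMW takes effect some time after it is triggered and no later than its response. Time $t$ of a run is the configuration after its $t$-th action. A run is *fair* if every RMW triggered by a correct (never crashing) client on a correct base object eventually responds and every correct client gets infinitely many opportunities to act. The register is *lock-free* if in every fair run, whenever a correct client has an outstanding operation, some operation returns later. It is *weakly regular* if for every run $r$ and every read $rd$ that returns in $r$, the writes of $r$ (all those that return, and any of the outstanding ones) together with $rd$ can be arranged in a sequence that respects the precedence order of $r$ (an operation precedes another if it returns before the other is invoked) and in which $rd$ returns the last value written before it, or $v_0$ if there is none. **Storage.** Let $D=\log_2|\mathbb V|$. Every stored bit is associated with one write, and its content is a function of the value of that write. The client executing a write can produce arbitrary bits of its own write; apart from this, clients and base objects can only keep, send or return bits whose contents are functions of the contents of the bits of the same write that are available to them. All other information (timestamps, identifiers, etc.) is not charged;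 clients executing writes, and base objects, compute it and choose their actions without looking at bit contents or written values, whereas clients executing reads may use the contents of the bits they hold in any way. The *storage size* at time $t$ is the number of bits stored in the base objects plus the number of bits associated with writes of other clients that are held (in local memory or in pending RMWs) by non-crashed clients with an outstanding write. Let $F(t)$ be the set of base objects that store, at time $t$, at least $D$ bits associated with some single write. **Theorem.** Let $S\in\mathbb N$ and $|\Pi|>S$. There is no algorithm that emulates a weakly regular, lock-free MWMR register in this model such that at every time $t$ of every run the storage size is less than $S$ and $|F(t)|\le f$. -/

import Mathlib

/-!
Emulation of a multi-writer multi-reader register over `n` fault-prone base objects that support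
atomic read-modify-write (RMW) access, accessed by a finite set `P` of asynchronous clients.

Storage model.  Every stored bit is associated with a single write and its content is a function of
the value of that write.  Everything else that clients and base objects keep (timestamps, operation
identifiers, the identity of the bits, ...) is bookkeeping information, which is not charged and
which an executing write or a base object computes without looking at the contents of the bits.
-/

namespace RegisterEmulation

open scoped Classical

noncomputable section

universe u v w

/-- `(c, k)` is the `k`-th high-level operation of client `c` (counted from `0`). -/
abbrev OpId (P : Type u) := P × ℕ

/-- A bit associated with the write `op`: if `op` writes `x`, then the content of the bit
is `val x`. -/
structure Bit (P : Type u) (V : Type v) where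
  op : OpId P
  val : V → Bool

/-- The content of `x` is a function of the contents of those bits in `A` that are associated with
the same write. -/
def Determined {P : Type u} {V : Type v} (A : Finset (Bit P V)) (x : Bit P V) : Prop :=
  ∀ a b : V, (∀ y ∈ A, y.op = x.op → y.val a = y.val b) → x.val a = x.val b

inductive OpKind (V : Type v) where
  | read : OpKind V
  | write (x : V) : OpKind V

/-- What a client does in one of its steps: nothing visible, trigger an RMW on a base object (a
request together with data bits), or return from its current operation. -/
inductive Move (n : ℕ) (P : Type u) (V : Type v) (Req : Type w) (R : Type v) where
  | wait : Move n P V Req R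
  | trigger (b : Fin n) (q : Req) (data : Finset (Bit P V)) : Move n P V Req R
  | ret (y : R) : Move n P V Req R

def Move.data {n : ℕ} {P : Type u} {V : Type v} {Req : Type w} {R : Type v} :
    Move n P V Req R → Finset (Bit P V)
  | .trigger _ _ data => data
  | _ => ∅

/-- An algorithm: deterministic clients, and the deterministic RMW functions of the base objects.

A client has a control state in `Ctl` and a set of bits in its memory; a base object has a
bookkeeping state in `Md` and a set of stored bits.  Arguments of type `Finset (Bit P V)` are bits
without their contents; only an executing read sees the contents of the bits in its memory
(last argument but for the result of `readStep`), and it may use them in any way. -/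
structure Algorithm (n : ℕ) (P : Type u) (V : Type v) where
  Ctl : Type w
  Md : Type w
  Req : Type w
  Resp : Type w
  /-- initial control states of the clients -/
  ctl₀ : P → Ctl
  /-- initial bookkeeping states of the base objects -/
  md₀ : Fin n → Md
  /-- change of the control state when a read is invoked -/
  invokeRead : OpId P → Ctl → Ctl
  /-- change of the control state when a write is invoked -/
  invokeWrite : OpId P → Ctl → Ctl
  /-- a step of a client that executes a read -/
  readStep : OpId P → Ctl → (mem : Finset (Bit P V)) → ({x // x ∈ mem} → Bool) →
    Ctl × Finset (Bit P V) × Move n P V Req V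
  /-- a step of a client that executes a write -/
  writeStep : OpId P → Ctl → Finset (Bit P V) → Ctl × Finset (Bit P V) × Move n P V Req PUnit
  /-- change of the state of a client that receives a response to a request it made -/
  receive : P → Ctl → Finset (Bit P V) → Fin n → Req → Resp → Finset (Bit P V) →
    Ctl × Finset (Bit P V)
  /-- the effect of a request and its data on a base object: new state, and response -/
  rmw : Fin n → Md → Finset (Bit P V) → Req → Finset (Bit P V) →
    (Md × Finset (Bit P V)) × (Resp × Finset (Bit P V))
  /-- A reader keeps and sends only bits that are computable from its memory. -/
  readStep_bits : ∀ o c mem h,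
    ∀ x ∈ (readStep o c mem h).2.1 ∪ (readStep o c mem h).2.2.data, Determined mem x
  /-- A writer, which knows its own value, may keep and send any bits of its own write, and
  otherwise only bits that are computable from its memory. -/
  writeStep_bits : ∀ o c mem,
    ∀ x ∈ (writeStep o c mem).2.1 ∪ (writeStep o c mem).2.2.data, x.op = o ∨ Determined mem x
  receive_bits : ∀ p c mem b q a data,
    ∀ x ∈ (receive p c mem b q a data).2, Determined (mem ∪ data) x
  rmw_bits : ∀ b m st q data,
    ∀ x ∈ (rmw b m st q data).1.2 ∪ (rmw b m st q data).2.2, Determined (st ∪ data) x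

variable {n : ℕ} {P : Type u} {V : Type v}

/-- A triggered RMW that has not responded yet.  `out = none` until it takes effect; afterwards
`out` is the response on its way to the client. -/
structure PendingRMW (A : Algorithm.{u, v, w} n P V) where
  client : P
  obj : Fin n
  req : A.Req
  data : Finset (Bit P V)
  out : Option (A.Resp × Finset (Bit P V))

/-- The bits a pending RMW carries. -/
def PendingRMW.carried {A : Algorithm.{u, v, w} n P V} (p : PendingRMW A) : Finset (Bit P V) :=
  match p.out with
  | none => p.data
  | some y => y.2

/-- Configurations: states of clients and base objects, pending RMWs, crashed components, and the
history of high-level operations. -/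
structure Config (A : Algorithm.{u, v, w} n P V) where
  ctl : P → A.Ctl
  mem : P → Finset (Bit P V)
  md : Fin n → A.Md
  store : Fin n → Finset (Bit P V)
  /-- the pending RMWs, by the number they got when they were triggered -/
  rmws : ℕ → Option (PendingRMW A)
  /-- number of RMWs triggered so far -/
  fresh : ℕ
  crashedClients : Finset P
  crashedObjects : Finset (Fin n)
  /-- number of operations that have returned, for each client -/
  seq : P → ℕ
  /-- the operations invoked so far -/
  kind : OpId P → Option (OpKind V)
  /-- the values returned by reads so far -/
  res : OpId P → Option V

def Config.init (A : Algorithm.{u, v, w} n P V) : Config A where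
  ctl := A.ctl₀
  mem := fun _ => ∅
  md := A.md₀
  store := fun _ => ∅
  rmws := fun _ => none
  fresh := 0
  crashedClients := ∅
  crashedObjects := ∅
  seq := fun _ => 0
  kind := fun _ => none
  res := fun _ => none

namespace Config

variable {A : Algorithm.{u, v, w} n P V}

def IsWrite (s : Config A) (o : OpId P) : Prop := ∃ x, s.kind o = some (.write x)

def Invoked (s : Config A) (o : OpId P) : Prop := s.kind o ≠ none

def Returned (s : Config A) (o : OpId P) : Prop := o.2 < s.seq o.1

/-- Client `c` has an outstanding operation (which is then its operation number `s.seq c`). -/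
def Busy (s : Config A) (c : P) : Prop := s.Invoked (c, s.seq c)

/-- Client `c` has an outstanding write. -/
def Writing (s : Config A) (c : P) : Prop := s.IsWrite (c, s.seq c)

/-- The content of a bit. (The default `false` concerns only bits labelled with an operation that
has not been invoked as a write; these are constant and carry no information.) -/
def content (s : Config A) (x : Bit P V) : Bool :=
  match s.kind x.op with
  | some (.write a) => x.val a
  | _ => false

/-- The result of a client step with new control state, new memory and move `y`; `g` tells which
returned value is recorded. -/
def afterMove (s : Config A) (c : P) {R : Type v} (g : R → Option V)
    (y : A.Ctl × Finset (Bit P V) × Move n P V A.Req R) : Config A :=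
  let s' : Config A :=
    { s with ctl := Function.update s.ctl c y.1, mem := Function.update s.mem c y.2.1 }
  match y.2.2 with
  | .wait => s'
  | .trigger b q data =>
      { s' with
        rmws := Function.update s.rmws s.fresh (some ⟨c, b, q, data, none⟩)
        fresh := s.fresh + 1 }
  | .ret r =>
      { s' with
        res := Function.update s.res (c, s.seq c) (g r)
        seq := Function.update s.seq c (s.seq c + 1) }

end Config

/-- The actions of a run.  `step c` is an opportunity for client `c` to act (to trigger an RMW or to
return); `effect i` lets the `i`-th RMW take effect on its base object, and `respond i` delivers
its response. -/
inductive Action (n : ℕ) (P : Type u) (V : Type v) where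
  | invokeRead (c : P) : Action n P V
  | invokeWrite (c : P) (x : V) : Action n P V
  | step (c : P) : Action n P V
  | effect (i : ℕ) : Action n P V
  | respond (i : ℕ) : Action n P V
  | crashClient (c : P) : Action n P V
  | crashObject (b : Fin n) : Action n P V

namespace Config

variable {A : Algorithm.{u, v, w} n P V}

/-- Which actions may occur, when at most `f` base objects may crash. -/
def Enabled (f : ℕ) (s : Config A) : Action n P V → Prop
  | .invokeRead c => c ∉ s.crashedClients ∧ ¬ s.Busy c
  | .invokeWrite c _ => c ∉ s.crashedClients ∧ ¬ s.Busy c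
  | .step c => c ∉ s.crashedClients
  | .effect i => ∃ p, s.rmws i = some p ∧ p.out = none ∧ p.obj ∉ s.crashedObjects
  | .respond i => ∃ p, s.rmws i = some p ∧ p.out ≠ none ∧ p.obj ∉ s.crashedObjects ∧
      p.client ∉ s.crashedClients
  | .crashClient c => c ∉ s.crashedClients
  | .crashObject b => b ∉ s.crashedObjects ∧ s.crashedObjects.card < f

/-- The configuration after an (enabled) action.  A client without an outstanding operation does
nothing in its steps. -/
def next (s : Config A) : Action n P V → Config A
  | .invokeRead c =>
      { s with
        ctl := Function.update s.ctl c (A.invokeRead (c, s.seq c) (s.ctl c))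
        kind := Function.update s.kind (c, s.seq c) (some .read) }
  | .invokeWrite c x =>
      { s with
        ctl := Function.update s.ctl c (A.invokeWrite (c, s.seq c) (s.ctl c))
        kind := Function.update s.kind (c, s.seq c) (some (.write x)) }
  | .step c =>
      match s.kind (c, s.seq c) with
      | none => s
      | some .read => s.afterMove c some
          (A.readStep (c, s.seq c) (s.ctl c) (s.mem c) (fun x => s.content x.1))
      | some (.write _) => s.afterMove c (fun _ => none)
          (A.writeStep (c, s.seq c) (s.ctl c) (s.mem c))
  | .effect i =>
      match s.rmws i with
      | none => s
      | some p =>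
          let y := A.rmw p.obj (s.md p.obj) (s.store p.obj) p.req p.data
          { s with
            md := Function.update s.md p.obj y.1.1
            store := Function.update s.store p.obj y.1.2
            rmws := Function.update s.rmws i (some { p with out := some y.2 }) }
  | .respond i =>
      match s.rmws i with
      | none => s
      | some p =>
        match p.out with
        | none => s
        | some a =>
            let y := A.receive p.client (s.ctl p.client) (s.mem p.client) p.obj p.req a.1 a.2
            { s with
              ctl := Function.update s.ctl p.client y.1
              mem := Function.update s.mem p.client y.2
              rmws := Function.update s.rmws i none }
  | .crashClient c => { s with crashedClients := insert c s.crashedClients }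
  | .crashObject b => { s with crashedObjects := insert b s.crashedObjects }

end Config

/-- The configuration after the first `t` of the given actions. -/
def configAt (A : Algorithm.{u, v, w} n P V) (act : ℕ → Action n P V) : ℕ → Config A
  | 0 => Config.init A
  | t + 1 => (configAt A act t).next (act t)

/-- A finite or infinite run, in which at most `f` base objects crash.  Transitions are
deterministic, so a run is given by its actions; the values of `act` from `len` on are
irrelevant. -/
structure Run (A : Algorithm.{u, v, w} n P V) (f : ℕ) where
  len : ℕ∞
  act : ℕ → Action n P V
  enabled : ∀ t : ℕ, (t : ℕ∞) < len → (configAt A act t).Enabled f (act t)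

namespace Run

variable {A : Algorithm.{u, v, w} n P V} {f : ℕ}

/-- The configuration at time `t`, for `t ≤ r.len`. -/
def cfg (r : Run A f) (t : ℕ) : Config A := configAt A r.act t

def CorrectClient (r : Run A f) (c : P) : Prop :=
  ∀ t : ℕ, (t : ℕ∞) ≤ r.len → c ∉ (r.cfg t).crashedClients

def CorrectObject (r : Run A f) (b : Fin n) : Prop :=
  ∀ t : ℕ, (t : ℕ∞) ≤ r.len → b ∉ (r.cfg t).crashedObjects

/-- Every RMW triggered by a correct client on a correct base object eventually responds, and
every correct client gets infinitely many opportunities to act. -/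
def Fair (r : Run A f) : Prop :=
  r.len = ⊤ ∧
  (∀ (t i : ℕ) (p : PendingRMW A), (r.cfg t).rmws i = some p → r.CorrectClient p.client →
    r.CorrectObject p.obj → ∃ t', r.act t' = .respond i) ∧
  (∀ c, r.CorrectClient c → ∀ t, ∃ t' ≥ t, r.act t' = .step c)

/-- `o` returns before `o'` is invoked. -/
def Precedes (r : Run A f) (o o' : OpId P) : Prop :=
  ∃ t : ℕ, (t : ℕ∞) ≤ r.len ∧ (r.cfg t).Returned o ∧ ¬ (r.cfg t).Invoked o'

/-- `o` is a write of `x` that is invoked in `r`. -/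
def WritesValue (r : Run A f) (o : OpId P) (x : V) : Prop :=
  ∃ t : ℕ, (t : ℕ∞) ≤ r.len ∧ (r.cfg t).kind o = some (.write x)

def Returns (r : Run A f) (o : OpId P) : Prop :=
  ∃ t : ℕ, (t : ℕ∞) ≤ r.len ∧ (r.cfg t).Returned o

/-- `rd` is a read that returns `y` in `r`. -/
def ReadReturns (r : Run A f) (rd : OpId P) (y : V) : Prop :=
  ∃ t : ℕ, (t : ℕ∞) ≤ r.len ∧ (r.cfg t).res rd = some y

/-- The writes of `r` and the read `rd`, which returns `y`, have a linearization: a sequence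
(operation `o` is at place `pos o`) of `rd`, all writes that return and some of the outstanding
writes, which respects the precedence order and in which `y` is the latest value written before
`rd`, or the initial value `v₀` if there is none. -/
def HasLinearization (r : Run A f) (v₀ : V) (rd : OpId P) (y : V) : Prop :=
  ∃ (W : Set (OpId P)) (pos : OpId P → ℕ),
    (∀ o ∈ W, ∃ x, r.WritesValue o x) ∧
    (∀ o x, r.WritesValue o x → r.Returns o → o ∈ W) ∧
    Set.InjOn pos (insert rd W) ∧
    (∀ o ∈ insert rd W, ∀ o' ∈ insert rd W, r.Precedes o o' → pos o < pos o') ∧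
    ((∃ o ∈ W, r.WritesValue o y ∧ pos o < pos rd ∧
        ∀ o' ∈ W, pos o' < pos rd → pos o' ≤ pos o) ∨
      (y = v₀ ∧ ∀ o ∈ W, pos rd < pos o))

end Run

/-- The emulated register with initial value `v₀` is weakly regular. -/
def WeaklyRegular (A : Algorithm.{u, v, w} n P V) (f : ℕ) (v₀ : V) : Prop :=
  ∀ (r : Run A f) (rd : OpId P) (y : V), r.ReadReturns rd y → r.HasLinearization v₀ rd y

/-- In every fair run: whenever a correct client has an outstanding operation, some operation
returns later. -/
def LockFree (A : Algorithm.{u, v, w} n P V) (f : ℕ) : Prop :=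
  ∀ r : Run A f, r.Fair → ∀ (t : ℕ) (c : P), r.CorrectClient c → (r.cfg t).Busy c →
    ∃ t' ≥ t, ∃ c' : P, (r.cfg t).seq c' < (r.cfg t').seq c'

namespace Config

variable {A : Algorithm.{u, v, w} n P V}

/-- The bits associated with writes of other clients that client `c` holds, in its memory or in its
pending RMWs. -/
def foreignBits (s : Config A) (c : P) : Finset (Bit P V) :=
  (s.mem c ∪ (Finset.range s.fresh).biUnion fun i =>
    match s.rmws i with
    | some p => if p.client = c then p.carried else ∅
    | none => ∅).filter fun x => x.op.1 ≠ c

/-- The storage size in bits: all bits in the base objects, and the bits of writes of other clients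
that are held by the non-crashed clients that are executing a write.  (What a writer keeps of its
own value, and the working memory of readers, are not charged.) -/
def storage [Fintype P] (s : Config A) : ℕ :=
  ∑ b, (s.store b).card +
    ∑ c with c ∉ s.crashedClients ∧ s.Writing c, (s.foreignBits c).card

/-- The base objects that store at least `D = log₂ |V|` bits of some single write. -/
def full [Fintype V] (s : Config A) : Finset (Fin n) :=
  Finset.univ.filter fun b => ∃ o, s.IsWrite o ∧
    Real.logb 2 (Fintype.card V) ≤ (((s.store b).filter fun x => x.op = o).card : ℝ)

end Config

end

end RegisterEmulation

/-! The proof is an adversary argument. Let `S` clients, forming `W`, each invoke a write, and keep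
one further client `rd` aside. Call a write traceless if none of its bits is stored in a base object
or held by another client. Every other write of `W` accounts for at least one charged bit, so
storage below `S` always leaves a traceless one. The adversary schedules only clients whose write is
currently traceless, and only RMWs on base objects that are not full (`Guard` with `Active` and
`full`).

Under this schedule each write stays ambiguous: two values agree on all its bits outside its own
client and the full objects (`WritePhase.next`). An RMW of a traceless writer puts its bits on one
object only. Either that object becomes full, or it holds fewer than `log₂ |V|` bits of the write
and pigeonhole gives the pair.

Hence no write can return. Otherwise crash the full objects, at most `f`, and every client but `rd`,
and let `rd` read alone. Lock-freedom makes it return some `y`. By ambiguity every written value can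
be switched to one different from `y` without the reader noticing, and a write precedes the read, so
weak regularity fails (`not_weaklyRegular_of_ambiguous`).

On the other hand some write must return. Full objects are frozen, so the set of full objects grows
and stabilizes. From some time on each client is scheduled infinitely often or never; crashing the
stable full objects and the never scheduled clients turns the rest into a fair run, contradicting
lock-freedom (`not_lockFree_of_seq_next`). -/

/-! ### Strongly fair schedules -/

/-- Strongly fair scheduling: if some action is always admissible, then there is an infinite
schedule in which every action that is admissible infinitely often is taken infinitely often. -/
theorem exists_stronglyFair {σ τ : Type*} [Countable τ] (next : σ → τ → σ) (G : σ → τ → Prop)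
    (J : σ → Prop) (hex : ∀ s, J s → ∃ a, G s a) (hJ : ∀ s a, J s → G s a → J (next s a))
    (s₀ : σ) (h₀ : J s₀) :
    ∃ (s : ℕ → σ) (g : ℕ → τ), s 0 = s₀ ∧ (∀ t, s (t + 1) = next (s t) (g t)) ∧ (∀ t, J (s t)) ∧
      (∀ t, G (s t) (g t)) ∧
      ∀ a, (∀ T, ∃ t ≥ T, G (s t) a) → ∀ T, ∃ t ≥ T, g t = a := by
  classical
  obtain ⟨e, he⟩ := exists_injective_nat τ
  -- The scheduler takes an admissible action minimizing (times taken so far) + (index). Outside `J`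
  -- the choice is arbitrary and only makes `pick` total.
  have hpick : ∀ (s : σ) (cnt : τ → ℕ), ∃ b : τ, J s →
      G s b ∧ ∀ a, G s a → cnt b + e b ≤ cnt a + e a := by
    intro s cnt
    by_cases hs : J s
    · obtain ⟨b, hb, hmin⟩ := WellFounded.has_min (measure fun a => cnt a + e a).wf
        {a | G s a} (hex s hs)
      exact ⟨b, fun _ => ⟨hb, fun a ha => not_lt.1 (hmin a ha)⟩⟩
    · obtain ⟨b, -⟩ := hex s₀ h₀
      exact ⟨b, fun h => absurd h hs⟩
  choose pick hpick using hpick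
  let st : ℕ → σ × (τ → ℕ) := fun t => Nat.rec (s₀, fun _ => 0)
    (fun _ q => (next q.1 (pick q.1 q.2),
      Function.update q.2 (pick q.1 q.2) (q.2 (pick q.1 q.2) + 1))) t
  let g : ℕ → τ := fun t => pick (st t).1 (st t).2
  have hcnt : ∀ t, (st (t + 1)).2 = Function.update (st t).2 (g t) ((st t).2 (g t) + 1) :=
    fun t => rfl
  have hJt : ∀ t, J (st t).1 := by
    intro t
    induction t with
    | zero => exact h₀
    | succ t ih => exact hJ _ _ ih (hpick _ _ ih).1
  have hmono : ∀ a, Monotone fun t => (st t).2 a := by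
    refine fun a => monotone_nat_of_le_succ fun t => ?_
    rw [hcnt]
    by_cases h : a = g t
    · subst h; simp
    · simp [Function.update_of_ne h]
  refine ⟨fun t => (st t).1, g, rfl, fun t => rfl, hJt, fun t => (hpick _ _ (hJt t)).1, ?_⟩
  intro a ha T
  by_contra! hne
  have hconst : ∀ t ≥ T, (st t).2 a = (st T).2 a := by
    intro t ht
    induction t, ht using Nat.le_induction with
    | base => rfl
    | succ t ht ih => rw [hcnt, Function.update_of_ne (hne t ht).symm, ih]
  have hinf : {t | T ≤ t ∧ G (st t).1 a}.Infinite := by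
    refine Set.infinite_of_not_bddAbove fun ⟨M, hM⟩ => ?_
    obtain ⟨t, ht, hta⟩ := ha (max T (M + 1))
    have := hM (⟨(le_max_left _ _).trans ht, hta⟩ : t ∈ {t | T ≤ t ∧ G (st t).1 a})
    have := (le_max_right T (M + 1)).trans ht
    omega
  -- If `a` is never taken after `T`, its priority is frozen. Whenever it is admissible, the chosen
  -- action has index and count below that bound, and these pairs differ at different times because
  -- counts increase.
  refine hinf (Set.Finite.of_injOn (f := fun t => (e (g t), (st t).2 (g t)))
    (t := Set.Iic ((st T).2 a + e a) ×ˢ Set.Iic ((st T).2 a + e a)) ?_ ?_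
    ((Set.finite_Iic _).prod (Set.finite_Iic _)))
  · rintro t ⟨ht, hta⟩
    have h := (hpick _ (st t).2 (hJt t)).2 a hta
    rw [hconst t ht] at h
    change (st t).2 (g t) + e (g t) ≤ _ at h
    exact ⟨show e (g t) ≤ _ by omega, show (st t).2 (g t) ≤ _ by omega⟩
  · have hlt : ∀ t t', t < t' → g t = g t' → (st t).2 (g t) < (st t').2 (g t') := by
      intro t t' htt h
      have h1 := hmono (g t) (Nat.succ_le_of_lt htt)
      simp only [Nat.succ_eq_add_one, hcnt, Function.update_self] at h1
      rw [← h]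
      omega
    rintro t - t' - h
    simp only [Prod.mk.injEq] at h
    have hg := he h.1
    rcases lt_trichotomy t t' with h1 | h1 | h1
    · exact absurd h.2 (hlt _ _ h1 hg).ne
    · exact h1
    · exact absurd h.2 (hlt _ _ h1 hg.symm).ne'

/-! ### Single transitions of configurations -/

namespace RegisterEmulation

open scoped Classical

noncomputable section

universe u v w

variable {n f : ℕ} {P : Type u} {V : Type v} {A : Algorithm.{u, v, w} n P V}

instance Action.instCountable [Countable P] [Countable V] : Countable (Action n P V) := by
  let φ : Action n P V → P ⊕ (P × V) ⊕ P ⊕ ℕ ⊕ ℕ ⊕ P ⊕ Fin n := fun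
    | .invokeRead c => .inl c
    | .invokeWrite c x => .inr (.inl (c, x))
    | .step c => .inr (.inr (.inl c))
    | .effect i => .inr (.inr (.inr (.inl i)))
    | .respond i => .inr (.inr (.inr (.inr (.inl i))))
    | .crashClient c => .inr (.inr (.inr (.inr (.inr (.inl c)))))
    | .crashObject b => .inr (.inr (.inr (.inr (.inr (.inr b)))))
  refine Function.Injective.countable (f := φ) ?_
  intro a b h
  cases a <;> cases b <;> simp_all [φ]

namespace Config

/-- Some enabled action leads from `s` to `s'`. -/
def Step (f : ℕ) (s s' : Config A) : Prop := ∃ a, s.Enabled f a ∧ s' = s.next a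

/-- Some finite sequence of enabled actions leads from `s` to `s'`. -/
def Reach (f : ℕ) : Config A → Config A → Prop := Relation.ReflTransGen (Step f)

theorem Reach.step {s s' : Config A} (h : Reach f s s') {a : Action n P V}
    (ha : s'.Enabled f a) : Reach f s (s'.next a) :=
  Relation.ReflTransGen.tail h ⟨a, ha, rfl⟩

/-- The numbers of triggered RMWs are below `fresh`. -/
def FreshOK (s : Config A) : Prop := ∀ i ≥ s.fresh, s.rmws i = none

/-- Client `c` holds the bit `z` in its memory or in a pending RMW. -/
def Holds (s : Config A) (c : P) (z : Bit P V) : Prop :=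
  z ∈ s.mem c ∨ ∃ i p, s.rmws i = some p ∧ p.client = c ∧ z ∈ p.carried

/-- `a` is a step of a client in `K`, or the effect or the response of an RMW of a client in `K`
on a base object outside `B`. -/
def Guard (K : P → Prop) (B : Finset (Fin n)) (s : Config A) : Action n P V → Prop
  | .step c => K c
  | .effect i => ∃ p, s.rmws i = some p ∧ p.out = none ∧ K p.client ∧ p.obj ∉ B
  | .respond i => ∃ p, s.rmws i = some p ∧ p.out ≠ none ∧ K p.client ∧ p.obj ∉ B
  | _ => False

section afterMove

variable (s : Config A) (c : P) {R : Type v} (g : R → Option V)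
  (y : A.Ctl × Finset (Bit P V) × Move n P V A.Req R)

@[simp] theorem afterMove_kind : (s.afterMove c g y).kind = s.kind := by
  unfold afterMove; split <;> rfl

@[simp] theorem afterMove_store : (s.afterMove c g y).store = s.store := by
  unfold afterMove; split <;> rfl

@[simp] theorem afterMove_mem : (s.afterMove c g y).mem = Function.update s.mem c y.2.1 := by
  unfold afterMove; split <;> rfl

@[simp] theorem afterMove_crashedClients :
    (s.afterMove c g y).crashedClients = s.crashedClients := by
  unfold afterMove; split <;> rfl

@[simp] theorem afterMove_crashedObjects :
    (s.afterMove c g y).crashedObjects = s.crashedObjects := by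
  unfold afterMove; split <;> rfl

theorem afterMove_seq :
    ((s.afterMove c g y).seq = s.seq ∧ (s.afterMove c g y).res = s.res) ∨
      ((s.afterMove c g y).seq = Function.update s.seq c (s.seq c + 1) ∧
        ∃ r, (s.afterMove c g y).res = Function.update s.res (c, s.seq c) (g r)) := by
  unfold afterMove
  split
  · exact .inl ⟨rfl, rfl⟩
  · exact .inl ⟨rfl, rfl⟩
  · exact .inr ⟨rfl, _, rfl⟩

theorem afterMove_rmws :
    ((s.afterMove c g y).rmws = s.rmws ∧ (s.afterMove c g y).fresh = s.fresh) ∨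
      ((s.afterMove c g y).fresh = s.fresh + 1 ∧
        ∃ p : PendingRMW A, (s.afterMove c g y).rmws = Function.update s.rmws s.fresh (some p) ∧
          p.client = c ∧ p.carried = y.2.2.data) := by
  unfold afterMove
  split
  · exact .inl ⟨rfl, rfl⟩
  · rename_i h
    exact .inr ⟨rfl, _, rfl, rfl, by rw [h]; rfl⟩
  · exact .inl ⟨rfl, rfl⟩

theorem holds_afterMove {c' : P} {z : Bit P V} (h : (s.afterMove c g y).Holds c' z) :
    (c' ≠ c ∧ s.Holds c' z) ∨ (c' = c ∧ (s.Holds c z ∨ z ∈ y.2.1 ∪ y.2.2.data)) := by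
  by_cases hc : c' = c
  · subst hc
    refine .inr ⟨rfl, ?_⟩
    rcases h with h | ⟨i, p, hi, hp, hz⟩
    · simp only [afterMove_mem, Function.update_self] at h
      exact .inr (Finset.mem_union_left _ h)
    · rcases s.afterMove_rmws c' g y with ⟨h1, -⟩ | ⟨-, q, h1, h2, h3⟩
      · exact .inl (.inr ⟨i, p, h1 ▸ hi, hp, hz⟩)
      · rw [h1, Function.update_apply] at hi
        split at hi
        · cases hi
          exact .inr (Finset.mem_union_right _ (h3 ▸ hz))
        · exact .inl (.inr ⟨i, p, hi, hp, hz⟩)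
  · refine .inl ⟨hc, ?_⟩
    rcases h with h | ⟨i, p, hi, hp, hz⟩
    · simp only [afterMove_mem, Function.update_of_ne hc] at h
      exact .inl h
    · rcases s.afterMove_rmws c g y with ⟨h1, -⟩ | ⟨-, q, h1, h2, h3⟩
      · exact .inr ⟨i, p, h1 ▸ hi, hp, hz⟩
      · rw [h1, Function.update_apply] at hi
        split at hi
        · cases hi
          exact absurd (hp.symm.trans h2) hc
        · exact .inr ⟨i, p, hi, hp, hz⟩

end afterMove

theorem step_cases (s : Config A) (c : P) :
    (s.kind (c, s.seq c) = none ∧ s.next (.step c) = s) ∨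
    (s.kind (c, s.seq c) = some .read ∧ s.next (.step c) = s.afterMove c some
      (A.readStep (c, s.seq c) (s.ctl c) (s.mem c) (fun x => s.content x.1))) ∨
    (s.Writing c ∧ s.next (.step c) = s.afterMove c (fun _ => none)
      (A.writeStep (c, s.seq c) (s.ctl c) (s.mem c))) := by
  unfold Writing IsWrite
  simp only [next]
  rcases s.kind (c, s.seq c) with _ | _ | x <;> simp

theorem next_effect {s : Config A} {i : ℕ} {p : PendingRMW A} (h : s.rmws i = some p) :
    s.next (.effect i) =
      { s with
        md := Function.update s.md p.obj (A.rmw p.obj (s.md p.obj) (s.store p.obj) p.req p.data).1.1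
        store := Function.update s.store p.obj
          (A.rmw p.obj (s.md p.obj) (s.store p.obj) p.req p.data).1.2
        rmws := Function.update s.rmws i (some { p with
          out := some (A.rmw p.obj (s.md p.obj) (s.store p.obj) p.req p.data).2 }) } := by
  simp [next, h]

theorem next_respond {s : Config A} {i : ℕ} {p : PendingRMW A} {y : A.Resp × Finset (Bit P V)}
    (h : s.rmws i = some p) (hy : p.out = some y) :
    s.next (.respond i) =
      { s with
        ctl := Function.update s.ctl p.client
          (A.receive p.client (s.ctl p.client) (s.mem p.client) p.obj p.req y.1 y.2).1
        mem := Function.update s.mem p.client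
          (A.receive p.client (s.ctl p.client) (s.mem p.client) p.obj p.req y.1 y.2).2
        rmws := Function.update s.rmws i none } := by
  simp [next, h, hy]

theorem next_effect_none {s : Config A} {i : ℕ} (h : s.rmws i = none) :
    s.next (.effect i) = s := by
  simp [next, h]

theorem next_respond_none {s : Config A} {i : ℕ}
    (h : ∀ p y, s.rmws i = some p → p.out ≠ some y) : s.next (.respond i) = s := by
  rcases hi : s.rmws i with _ | p
  · simp [next, hi]
  · rcases ho : p.out with _ | y
    · simp [next, hi, ho]
    · exact absurd ho (h p y hi)

/-- Delivering a response has no effect unless there is one. -/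
theorem respond_cases (s : Config A) (i : ℕ) :
    s.next (.respond i) = s ∨ ∃ p y, s.rmws i = some p ∧ p.out = some y := by
  by_cases h : ∃ p y, s.rmws i = some p ∧ p.out = some y
  · exact .inr h
  · push Not at h
    exact .inl (next_respond_none h)

theorem effect_cases (s : Config A) (i : ℕ) :
    s.next (.effect i) = s ∨ ∃ p, s.rmws i = some p := by
  rcases hi : s.rmws i with _ | p
  · exact .inl (next_effect_none hi)
  · exact .inr ⟨p, rfl⟩

theorem FreshOK.lt {s : Config A} (hs : s.FreshOK) {i : ℕ} {p : PendingRMW A}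
    (h : s.rmws i = some p) : i < s.fresh := by
  by_contra hi
  rw [hs i (not_lt.1 hi)] at h
  cases h

theorem FreshOK.afterMove {s : Config A} (hs : s.FreshOK) (c : P) {R : Type v} (g : R → Option V)
    (y : A.Ctl × Finset (Bit P V) × Move n P V A.Req R) : (s.afterMove c g y).FreshOK := by
  intro j hj
  rcases s.afterMove_rmws c g y with ⟨h1, h2⟩ | ⟨h2, q, h1, -, -⟩
  · rw [h1]; exact hs j (h2 ▸ hj)
  · rw [h2] at hj
    rw [h1, Function.update_of_ne (by omega)]
    exact hs j (by omega)

theorem FreshOK.next {s : Config A} (hs : s.FreshOK) (a : Action n P V) : (s.next a).FreshOK := by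
  cases a with
  | invokeRead c => exact hs
  | invokeWrite c x => exact hs
  | crashClient c => exact hs
  | crashObject b => exact hs
  | step c =>
    rcases s.step_cases c with ⟨-, h⟩ | ⟨-, h⟩ | ⟨-, h⟩ <;> rw [h]
    · exact hs
    · exact hs.afterMove _ _ _
    · exact hs.afterMove _ _ _
  | effect i =>
    rcases s.effect_cases i with h | ⟨p, hp⟩
    · rw [h]; exact hs
    · rw [next_effect hp]
      intro j hj
      have h1 := hs.lt hp
      change s.fresh ≤ j at hj
      change Function.update s.rmws i _ j = none
      rw [Function.update_of_ne (by omega)]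
      exact hs j hj
  | respond i =>
    rcases s.respond_cases i with h | ⟨p, y, hp, hy⟩
    · rw [h]; exact hs
    · rw [next_respond hp hy]
      intro j hj
      have h1 := hs.lt hp
      change s.fresh ≤ j at hj
      change Function.update s.rmws i _ j = none
      rw [Function.update_of_ne (by omega)]
      exact hs j hj

/-- A pending RMW stays pending until it responds. -/
theorem FreshOK.rmws_next {s : Config A} (hs : s.FreshOK) {i : ℕ} {p : PendingRMW A}
    (hp : s.rmws i = some p) {a : Action n P V} (ha : a ≠ .respond i) :
    ∃ p', (s.next a).rmws i = some p' ∧ p'.client = p.client ∧ p'.obj = p.obj ∧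
      (p.out ≠ none ∨ a = .effect i → p'.out ≠ none) := by
  have hi := hs.lt hp
  -- A new RMW gets the number `s.fresh > i`, so it does not overwrite entry `i`.
  have hmove : ∀ (c : P) {R : Type v} (g : R → Option V)
      (y : A.Ctl × Finset (Bit P V) × Move n P V A.Req R),
      (s.afterMove c g y).rmws i = some p := by
    intro c R g y
    rcases s.afterMove_rmws c g y with ⟨h1, -⟩ | ⟨-, q, h1, -, -⟩
    · rw [h1, hp]
    · rw [h1, Function.update_of_ne (by omega), hp]
  cases a with
  | invokeRead c => exact ⟨p, hp, rfl, rfl, by simp⟩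
  | invokeWrite c x => exact ⟨p, hp, rfl, rfl, by simp⟩
  | crashClient c => exact ⟨p, hp, rfl, rfl, by simp⟩
  | crashObject b => exact ⟨p, hp, rfl, rfl, by simp⟩
  | step c =>
    refine ⟨p, ?_, rfl, rfl, by simp⟩
    rcases s.step_cases c with ⟨-, h⟩ | ⟨-, h⟩ | ⟨-, h⟩ <;> rw [h]
    · exact hp
    · exact hmove _ _ _
    · exact hmove _ _ _
  | effect j =>
    rcases s.effect_cases j with h | ⟨q, hq⟩
    · rw [h]
      refine ⟨p, hp, rfl, rfl, ?_⟩
      rintro (h1 | h1)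
      · exact h1
      · cases h1
        -- An effect that leaves `s` unchanged can only rewrite an RMW whose response was already
        -- there.
        have := congrArg (fun s => s.rmws i) h
        simp only [next_effect hp, Function.update_self, hp, Option.some.injEq] at this
        rw [← this]
        simp
    · rw [next_effect hq]
      by_cases hij : i = j
      · subst hij
        obtain rfl : p = q := by simpa [hp] using hq
        exact ⟨_, Function.update_self .., rfl, rfl, by simp⟩
      · refine ⟨p, ?_, rfl, rfl, ?_⟩
        · exact (Function.update_of_ne hij ..).trans hp
        · rintro (h1 | h1)
          · exact h1
          · cases h1; exact absurd rfl hij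
  | respond j =>
    have hij : i ≠ j := by rintro rfl; exact ha rfl
    rcases s.respond_cases j with h | ⟨q, y, hq, hy⟩
    · rw [h]; exact ⟨p, hp, rfl, rfl, by simp⟩
    · rw [next_respond hq hy]
      exact ⟨p, (Function.update_of_ne hij ..).trans hp, rfl, rfl, by simp⟩

theorem crashedClients_subset_next (s : Config A) (a : Action n P V) :
    s.crashedClients ⊆ (s.next a).crashedClients := by
  cases a with
  | crashClient c => exact Finset.subset_insert _ _
  | step c => rcases s.step_cases c with ⟨-, h⟩ | ⟨-, h⟩ | ⟨-, h⟩ <;> rw [h] <;> simp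
  | effect i =>
    rcases s.effect_cases i with h | ⟨p, hp⟩
    · rw [h]
    · rw [next_effect hp]
  | respond i =>
    rcases s.respond_cases i with h | ⟨p, y, hp, hy⟩
    · rw [h]
    · rw [next_respond hp hy]
  | _ => exact subset_rfl

/-- Invocations are enabled only for clients that are not busy, so they fill an empty slot and never
overwrite a recorded operation. -/
theorem kind_next {s : Config A} {a : Action n P V} (ha : s.Enabled f a) {o : OpId P}
    {k : OpKind V} (h : s.kind o = some k) : (s.next a).kind o = some k := by
  have hb : ∀ c, ¬ s.Busy c → o ≠ (c, s.seq c) := by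
    rintro c hc rfl
    exact hc (by simp [Busy, Invoked, h])
  cases a with
  | invokeRead c => exact (Function.update_of_ne (hb c ha.2) ..).trans h
  | invokeWrite c x => exact (Function.update_of_ne (hb c ha.2) ..).trans h
  | step c => rcases s.step_cases c with ⟨-, h'⟩ | ⟨-, h'⟩ | ⟨-, h'⟩ <;> rw [h'] <;> simp [h]
  | effect i =>
    rcases s.effect_cases i with h' | ⟨p, hp⟩
    · rw [h', h]
    · rw [next_effect hp, h]
  | respond i =>
    rcases s.respond_cases i with h' | ⟨p, y, hp, hy⟩
    · rw [h', h]
    · rw [next_respond hp hy, h]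
  | _ => exact h

/-! ### Transitions of selected clients on selected base objects -/

namespace Guard

variable {s : Config A} {K : P → Prop} {B : Finset (Fin n)} {a : Action n P V}

theorem next_kind (ha : s.Guard K B a) : (s.next a).kind = s.kind := by
  cases a with
  | step c => rcases s.step_cases c with ⟨-, h'⟩ | ⟨-, h'⟩ | ⟨-, h'⟩ <;> rw [h'] <;> simp
  | effect i =>
    obtain ⟨p, hp, -⟩ := ha
    rw [next_effect hp]
  | respond i =>
    rcases s.respond_cases i with h' | ⟨p, y, hp, hy⟩
    · rw [h']
    · rw [next_respond hp hy]
  | _ => exact ha.elim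

theorem next_crashedClients (ha : s.Guard K B a) :
    (s.next a).crashedClients = s.crashedClients := by
  cases a with
  | step c => rcases s.step_cases c with ⟨-, h'⟩ | ⟨-, h'⟩ | ⟨-, h'⟩ <;> rw [h'] <;> simp
  | effect i =>
    obtain ⟨p, hp, -⟩ := ha
    rw [next_effect hp]
  | respond i =>
    rcases s.respond_cases i with h' | ⟨p, y, hp, hy⟩
    · rw [h']
    · rw [next_respond hp hy]
  | _ => exact ha.elim

theorem next_crashedObjects (ha : s.Guard K B a) :
    (s.next a).crashedObjects = s.crashedObjects := by
  cases a with
  | step c => rcases s.step_cases c with ⟨-, h'⟩ | ⟨-, h'⟩ | ⟨-, h'⟩ <;> rw [h'] <;> simp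
  | effect i =>
    obtain ⟨p, hp, -⟩ := ha
    rw [next_effect hp]
  | respond i =>
    rcases s.respond_cases i with h' | ⟨p, y, hp, hy⟩
    · rw [h']
    · rw [next_respond hp hy]
  | _ => exact ha.elim

theorem enabled (ha : s.Guard K B a) (hK : ∀ c, K c → c ∉ s.crashedClients)
    (hB : s.crashedObjects ⊆ B) : s.Enabled f a := by
  cases a with
  | step c => exact hK c ha
  | effect i =>
    obtain ⟨p, hp, ho, hk, hb⟩ := ha
    exact ⟨p, hp, ho, fun h => hb (hB h)⟩
  | respond i =>
    obtain ⟨p, hp, ho, hk, hb⟩ := ha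
    exact ⟨p, hp, ho, fun h => hb (hB h), hK _ hk⟩
  | _ => exact ha.elim

/-- Only a step of client `c` changes the number of operations of `c` that have returned. -/
theorem next_seq (ha : s.Guard K B a) :
    ((s.next a).seq = s.seq ∧ (s.next a).res = s.res) ∨ ∃ c, a = .step c ∧ K c ∧ s.Busy c ∧
      (s.next a).seq = Function.update s.seq c (s.seq c + 1) ∧
      (s.kind (c, s.seq c) = some .read → ∃ y, (s.next a).res (c, s.seq c) = some y) := by
  cases a with
  | step c =>
    rcases s.step_cases c with ⟨-, h⟩ | ⟨hk, h⟩ | ⟨⟨x, hk⟩, h⟩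
    · rw [h]; exact .inl ⟨rfl, rfl⟩
    · rw [h]
      rcases afterMove_seq s c some
        (A.readStep (c, s.seq c) (s.ctl c) (s.mem c) (fun x => s.content x.1)) with h1 | ⟨h1, r, h2⟩
      · exact .inl h1
      · exact .inr ⟨c, rfl, ha, by simp [Busy, Invoked, hk], h1,
          fun _ => ⟨r, by rw [h2, Function.update_self]⟩⟩
    · rw [h]
      rcases afterMove_seq s c (fun _ => none)
        (A.writeStep (c, s.seq c) (s.ctl c) (s.mem c)) with h1 | ⟨h1, r, h2⟩
      · exact .inl h1
      · exact .inr ⟨c, rfl, ha, by simp [Busy, Invoked, hk], h1, fun h' => by simp [hk] at h'⟩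
  | effect i =>
    obtain ⟨p, hp, -⟩ := ha
    rw [next_effect hp]; exact .inl ⟨rfl, rfl⟩
  | respond i =>
    rcases s.respond_cases i with h' | ⟨p, y, hp, hy⟩
    · rw [h']; exact .inl ⟨rfl, rfl⟩
    · rw [next_respond hp hy]; exact .inl ⟨rfl, rfl⟩
  | _ => exact ha.elim

/-- Clients that do not act get no bits. -/
theorem holds_of_next (ha : s.Guard K B a) {c : P} (hc : ¬ K c) {z : Bit P V}
    (hz : (s.next a).Holds c z) : s.Holds c z := by
  cases a with
  | step d =>
    have hcd : c ≠ d := by rintro rfl; exact hc ha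
    rcases s.step_cases d with ⟨-, h⟩ | ⟨hk, h⟩ | ⟨⟨x, hk⟩, h⟩ <;> rw [h] at hz
    · exact hz
    · exact (holds_afterMove _ _ _ _ hz).elim (·.2) fun h' => absurd h'.1 hcd
    · exact (holds_afterMove _ _ _ _ hz).elim (·.2) fun h' => absurd h'.1 hcd
  | effect i =>
    obtain ⟨p, hp, -, hk, -⟩ := ha
    have hcp : p.client ≠ c := by rintro rfl; exact hc hk
    rw [next_effect hp] at hz
    rcases hz with hz | ⟨j, q, hj, hq, hz⟩
    · exact .inl hz
    · simp only [Function.update_apply] at hj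
      split at hj
      · cases hj; exact absurd hq hcp
      · exact .inr ⟨j, q, hj, hq, hz⟩
  | respond i =>
    obtain ⟨p, hp, ho, hk, -⟩ := ha
    obtain ⟨y, hy⟩ := Option.ne_none_iff_exists'.1 ho
    have hcp : c ≠ p.client := by rintro rfl; exact hc hk
    rw [next_respond hp hy] at hz
    rcases hz with hz | ⟨j, q, hj, hq, hz⟩
    · simp only [Function.update_of_ne hcp] at hz
      exact .inl hz
    · simp only [Function.update_apply] at hj
      split at hj
      · cases hj
      · exact .inr ⟨j, q, hj, hq, hz⟩
  | _ => exact ha.elim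

/-- A property of bits which is inherited by bits determined by others spreads only from clients
and base objects that interact. -/
theorem next_clean (ha : s.Guard K B a) {C : Set P} {D : Set (Fin n)} {g : Bit P V → Prop}
    (hdet : ∀ (M : Finset (Bit P V)) z, (∀ y ∈ M, g y) → Determined M z → g z)
    (hC : ∀ c ∈ C, ∀ z, s.Holds c z → g z) (hD : ∀ b ∈ D, ∀ z ∈ s.store b, g z)
    (hown : ∀ c ∈ C, s.Writing c → ∀ z : Bit P V, z.op = (c, s.seq c) → g z)
    (heff : ∀ i p, a = .effect i → s.rmws i = some p → (p.client ∈ C ↔ p.obj ∈ D)) :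
    (∀ c ∈ C, ∀ z, (s.next a).Holds c z → g z) ∧ ∀ b ∈ D, ∀ z ∈ (s.next a).store b, g z := by
  cases a with
  | step d =>
    rcases s.step_cases d with ⟨-, h⟩ | ⟨hk, h⟩ | ⟨hw, h⟩ <;> rw [h]
    · exact ⟨hC, hD⟩
    · refine ⟨fun c hc z hz => ?_, by simpa using hD⟩
      rcases holds_afterMove _ _ _ _ hz with h' | ⟨rfl, h' | h'⟩
      · exact hC c hc z h'.2
      · exact hC _ hc z h'
      · exact hdet _ z (fun y hy => hC _ hc y (.inl hy)) (A.readStep_bits _ _ _ _ z h')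
    · refine ⟨fun c hc z hz => ?_, by simpa using hD⟩
      rcases holds_afterMove _ _ _ _ hz with h' | ⟨rfl, h' | h'⟩
      · exact hC c hc z h'.2
      · exact hC _ hc z h'
      · rcases A.writeStep_bits _ _ _ z h' with h' | h'
        · exact hown _ hc hw z h'
        · exact hdet _ z (fun y hy => hC _ hc y (.inl hy)) h'
  | effect i =>
    obtain ⟨p, hp, ho, -, -⟩ := ha
    -- An effect mixes the bits of a client and an object; since both or neither lie in the
    -- protected sets, nothing leaks in from outside.
    have hiff := heff i p rfl hp
    have hdata : p.client ∈ C → ∀ z ∈ p.data, g z := fun hc z hz =>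
      hC _ hc z (.inr ⟨i, p, hp, rfl, by simpa [PendingRMW.carried, ho] using hz⟩)
    have hnew : p.client ∈ C → ∀ z ∈ (A.rmw p.obj (s.md p.obj) (s.store p.obj) p.req p.data).1.2 ∪
        (A.rmw p.obj (s.md p.obj) (s.store p.obj) p.req p.data).2.2, g z := by
      intro hc z hz
      refine hdet _ z (fun y hy => ?_) (A.rmw_bits _ _ _ _ _ z hz)
      rcases Finset.mem_union.1 hy with hy | hy
      · exact hD _ (hiff.1 hc) y hy
      · exact hdata hc y hy
    rw [next_effect hp]
    refine ⟨fun c hc z hz => ?_, fun b hb z hz => ?_⟩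
    · rcases hz with hz | ⟨j, q, hj, hq, hz⟩
      · exact hC c hc z (.inl hz)
      · simp only [Function.update_apply] at hj
        split at hj
        · cases hj
          cases hq
          exact hnew hc z (Finset.mem_union_right _ hz)
        · exact hC c hc z (.inr ⟨j, q, hj, hq, hz⟩)
    · simp only [Function.update_apply] at hz
      split at hz
      · rename_i hbp
        subst hbp
        exact hnew (hiff.2 hb) z (Finset.mem_union_left _ hz)
      · exact hD b hb z hz
  | respond i =>
    obtain ⟨p, hp, ho, -, -⟩ := ha
    obtain ⟨y, hy⟩ := Option.ne_none_iff_exists'.1 ho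
    rw [next_respond hp hy]
    refine ⟨fun c hc z hz => ?_, hD⟩
    rcases hz with hz | ⟨j, q, hj, hq, hz⟩
    · simp only [Function.update_apply] at hz
      split at hz
      · rename_i hcp
        subst hcp
        refine hdet _ z (fun x hx => ?_) (A.receive_bits _ _ _ _ _ _ _ z hz)
        rcases Finset.mem_union.1 hx with hx | hx
        · exact hC _ hc x (.inl hx)
        · exact hC _ hc x (.inr ⟨i, p, hp, rfl, by simpa [PendingRMW.carried, hy] using hx⟩)
      · exact hC c hc z (.inl hz)
    · simp only [Function.update_apply] at hj
      split at hj
      · cases hj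
      · exact hC c hc z (.inr ⟨j, q, hj, hq, hz⟩)
  | _ => exact ha.elim

end Guard

end Config

/-! ### Runs and their continuations -/

theorem configAt_congr {act act' : ℕ → Action n P V} {t : ℕ} (h : ∀ i < t, act i = act' i) :
    configAt A act t = configAt A act' t := by
  induction t with
  | zero => rfl
  | succ t ih =>
    simp only [configAt]
    rw [ih fun i hi => h i (by omega), h t (by omega)]

theorem configAt_freshOK (act : ℕ → Action n P V) (t : ℕ) : (configAt A act t).FreshOK := by
  induction t with
  | zero => exact fun i _ => rfl
  | succ t ih => exact ih.next _

namespace Run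

/-- A finite run can be continued by an enabled action. -/
theorem exists_snoc (r : Run A f) {L : ℕ} (hL : r.len = L) {a : Action n P V}
    (ha : (r.cfg L).Enabled f a) :
    ∃ r' : Run A f, r'.len = (L + 1 : ℕ) ∧ (∀ t ≤ L, r'.cfg t = r.cfg t) ∧
      r'.cfg (L + 1) = (r.cfg L).next a := by
  let act' : ℕ → Action n P V := fun t => if t < L then r.act t else a
  have hcfg : ∀ t ≤ L, configAt A act' t = r.cfg t := fun t ht =>
    configAt_congr fun i hi => if_pos (by omega)
  have hact : act' L = a := if_neg (lt_irrefl _)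
  refine ⟨⟨(L + 1 : ℕ), act', fun t ht => ?_⟩, rfl, hcfg, ?_⟩
  · rw [Nat.cast_lt] at ht
    rw [hcfg t (by omega)]
    by_cases h : t < L
    · have : act' t = r.act t := if_pos h
      rw [this]
      exact r.enabled t (by rw [hL]; exact_mod_cast h)
    · obtain rfl : t = L := by omega
      rw [hact]; exact ha
  · change (configAt A act' L).next (act' L) = _
    rw [hcfg L le_rfl, hact]

theorem exists_append (r : Run A f) {L : ℕ} (hL : r.len = L) {s : Config A}
    (hs : Config.Reach f (r.cfg L) s) :
    ∃ (r' : Run A f) (L' : ℕ), r'.len = L' ∧ L ≤ L' ∧ (∀ t ≤ L, r'.cfg t = r.cfg t) ∧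
      r'.cfg L' = s := by
  induction hs with
  | refl => exact ⟨r, L, hL, le_rfl, fun _ _ => rfl, rfl⟩
  | tail _ h ih =>
    obtain ⟨r', L', h1, h2, h3, rfl⟩ := ih
    obtain ⟨a, ha, rfl⟩ := h
    obtain ⟨r'', h1', h3', h4'⟩ := r'.exists_snoc h1 ha
    exact ⟨r'', L' + 1, h1', by omega, fun t ht => (h3' t (by omega)).trans (h3 t ht), h4'⟩

variable (A) in
/-- The run without actions. -/
def nil : Run A f where
  len := 0
  act := fun i => .effect i
  enabled := fun t ht => absurd ht (by simp)

theorem exists_of_reach {s : Config A} (hs : Config.Reach f (Config.init A) s) :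
    ∃ (r : Run A f) (L : ℕ), r.len = L ∧ r.cfg L = s := by
  obtain ⟨r, L, h1, -, -, h2⟩ := (nil (f := f) A).exists_append (L := 0) rfl hs
  exact ⟨r, L, h1, h2⟩

/-- A finite run can be continued by an infinite sequence of enabled actions. -/
theorem exists_extend (r : Run A f) {L : ℕ} (hL : r.len = L) {σ : ℕ → Config A}
    {g : ℕ → Action n P V} (h₀ : σ 0 = r.cfg L) (hσ : ∀ t, σ (t + 1) = (σ t).next (g t))
    (hg : ∀ t, (σ t).Enabled f (g t)) :
    ∃ r' : Run A f, r'.len = ⊤ ∧ ∀ t, r'.cfg (L + t) = σ t ∧ r'.act (L + t) = g t := by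
  let act' : ℕ → Action n P V := fun t => if t < L then r.act t else g (t - L)
  have hcfg : ∀ t ≤ L, configAt A act' t = r.cfg t := fun t ht =>
    configAt_congr fun i hi => if_pos (by omega)
  have hact : ∀ t, act' (L + t) = g t := fun t =>
    (if_neg (by omega)).trans (by rw [Nat.add_sub_cancel_left])
  have hcfg' : ∀ t, configAt A act' (L + t) = σ t := by
    intro t
    induction t with
    | zero => rw [h₀]; exact hcfg L le_rfl
    | succ t ih =>
      rw [hσ, ← ih, ← hact t]; rfl
  refine ⟨⟨⊤, act', fun t _ => ?_⟩, rfl, fun t => ⟨hcfg' t, hact t⟩⟩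
  by_cases h : t < L
  · have : act' t = r.act t := if_pos h
    rw [hcfg t h.le, this]
    exact r.enabled t (by rw [hL]; exact_mod_cast h)
  · obtain ⟨k, rfl⟩ := Nat.exists_eq_add_of_le (not_lt.1 h)
    rw [hcfg', hact]
    exact hg k

theorem crashedClients_mono (r : Run A f) {t t' : ℕ} (h : t ≤ t') :
    (r.cfg t).crashedClients ⊆ (r.cfg t').crashedClients := by
  induction t', h using Nat.le_induction with
  | base => exact subset_rfl
  | succ t' _ ih => exact ih.trans (Config.crashedClients_subset_next _ _)

theorem kind_persist (r : Run A f) {t t' : ℕ} (h : t ≤ t') (ht' : (t' : ℕ∞) ≤ r.len) {o : OpId P}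
    {k : OpKind V} (hk : (r.cfg t).kind o = some k) : (r.cfg t').kind o = some k := by
  induction t', h using Nat.le_induction with
  | base => exact hk
  | succ t' _ ih =>
    have hlt : (t' : ℕ∞) < r.len := lt_of_lt_of_le (by exact_mod_cast Nat.lt_succ_self t') ht'
    exact Config.kind_next (r.enabled t' hlt) (ih hlt.le)

end Run

/-! ### Lock-freedom along strongly fair schedules -/

/-- Lock-freedom, for continuations of a reachable configuration in which no crashes and no
invocations occur.  The clients in `K t` are those that may act at time `t`. -/
theorem LockFree.exists_return (hA : LockFree A f) {σ : ℕ → Config A} {g : ℕ → Action n P V}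
    (hreach : Config.Reach f (Config.init A) (σ 0)) (hσ : ∀ t, σ (t + 1) = (σ t).next (g t))
    {K : ℕ → P → Prop} {B : Finset (Fin n)} (hB : (σ 0).crashedObjects = B)
    (hg : ∀ t, (σ t).Guard (K t) B (g t))
    (hK : ∀ t c, K t c → c ∉ (σ 0).crashedClients)
    (hKinf : ∀ c ∉ (σ 0).crashedClients, ∀ T, ∃ t ≥ T, K t c)
    (hfair : ∀ a, (∀ T, ∃ t ≥ T, (σ t).Guard (K t) B a) → ∀ T, ∃ t ≥ T, g t = a)
    {c : P} (hc : c ∉ (σ 0).crashedClients) (hbusy : (σ 0).Busy c) :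
    ∃ t c', (σ 0).seq c' < (σ t).seq c' := by
  have hcC : ∀ t, (σ t).crashedClients = (σ 0).crashedClients := by
    intro t
    induction t with
    | zero => rfl
    | succ t ih => rw [hσ, (hg t).next_crashedClients, ih]
  have hcB : ∀ t, (σ t).crashedObjects = B := by
    intro t
    induction t with
    | zero => exact hB
    | succ t ih => rw [hσ, (hg t).next_crashedObjects, ih]
  obtain ⟨r₀, L, hL, hs⟩ := Run.exists_of_reach hreach
  obtain ⟨r, hr, hr'⟩ := r₀.exists_extend hL hs.symm hσ fun t =>
    (hg t).enabled (fun c h => by rw [hcC]; exact hK t c h) (hcB t).subset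
  have hle : ∀ t : ℕ, (t : ℕ∞) ≤ r.len := fun t => by rw [hr]; exact le_top
  have hcorr : ∀ c, r.CorrectClient c → c ∉ (σ 0).crashedClients := fun c h => by
    have := h L (hle L)
    rwa [← (hr' 0).1]
  have hcorr' : ∀ c ∉ (σ 0).crashedClients, r.CorrectClient c := by
    intro c hc t _ hct
    have := r.crashedClients_mono (Nat.le_add_left t L) hct
    rw [(hr' t).1, hcC] at this
    exact hc this
  have hobj : ∀ b, r.CorrectObject b → b ∉ B := fun b h => by
    have := h L (hle L)
    rwa [← Nat.add_zero L, (hr' 0).1, hcB] at this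
  have hF : r.Fair := by
    refine ⟨hr, fun t i p hp hcl hob => ?_, fun c hc t => ?_⟩
    · by_contra! hne
      have hpers : ∀ t' ≥ t, ∃ p', (r.cfg t').rmws i = some p' ∧ p'.client = p.client ∧
          p'.obj = p.obj := by
        intro t' ht'
        induction t', ht' using Nat.le_induction with
        | base => exact ⟨p, hp, rfl, rfl⟩
        | succ t' _ ih =>
          obtain ⟨p', h1, h2, h3⟩ := ih
          obtain ⟨p'', h1', h2', h3', -⟩ :=
            (configAt_freshOK r.act t').rmws_next h1 (hne t')
          exact ⟨p'', h1', h2'.trans h2, h3'.trans h3⟩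
      have hpers' : ∀ k ≥ t, ∃ p', (σ k).rmws i = some p' ∧ p'.client = p.client ∧
          p'.obj = p.obj := fun k hk => by
        rw [← (hr' k).1]; exact hpers (L + k) (by omega)
      have hnr : ∀ k, g k ≠ .respond i := fun k => by rw [← (hr' k).2]; exact hne _
      have hfr : ∀ k, (σ k).FreshOK := fun k => by rw [← (hr' k).1]; exact configAt_freshOK _ _
      -- While the RMW has not taken effect, its effect is admissible whenever its client may act,
      -- hence infinitely often, so strong fairness forces it. The same argument then forces the
      -- response. Plain fairness would not do, as clients may be allowed to act only
      -- intermittently.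
      have hout : ∃ k ≥ t, ∃ p', (σ k).rmws i = some p' ∧ p'.out ≠ none := by
        by_contra! hno
        obtain ⟨k, hk, hgk⟩ := hfair (.effect i) (fun T => by
          obtain ⟨k, hk, hKk⟩ := hKinf p.client (hcorr _ hcl) (max T t)
          obtain ⟨p', h1, h2, h3⟩ := hpers' k ((le_max_right _ _).trans hk)
          exact ⟨k, (le_max_left _ _).trans hk, p', h1,
            hno k ((le_max_right _ _).trans hk) p' h1, h2 ▸ hKk, h3 ▸ hobj _ hob⟩) t
        obtain ⟨p', h1, -⟩ := hpers' k hk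
        obtain ⟨p'', h1', -, -, h4⟩ := (hfr k).rmws_next h1 (hnr k)
        rw [← hσ] at h1'
        exact h4 (.inr hgk) (hno (k + 1) (by omega) p'' h1')
      obtain ⟨k₀, hk₀, hout⟩ := hout
      have hout' : ∀ k ≥ k₀, ∃ p', (σ k).rmws i = some p' ∧ p'.out ≠ none := by
        intro k hk
        induction k, hk using Nat.le_induction with
        | base => exact hout
        | succ k _ ih =>
          obtain ⟨p', h1, h2⟩ := ih
          obtain ⟨p'', h1', -, -, h4⟩ := (hfr k).rmws_next h1 (hnr k)
          exact ⟨p'', by rw [hσ, h1'], h4 (.inl h2)⟩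
      obtain ⟨k, hk, hgk⟩ := hfair (.respond i) (fun T => by
        obtain ⟨k, hk, hKk⟩ := hKinf p.client (hcorr _ hcl) (max T k₀)
        have hkk := (le_max_right _ _).trans hk
        obtain ⟨p', h1, h2, h3⟩ := hpers' k (hk₀.trans hkk)
        obtain ⟨p'', h1', h4⟩ := hout' k hkk
        obtain rfl : p' = p'' := by simpa [h1] using h1'
        exact ⟨k, (le_max_left _ _).trans hk, p', h1, h4, h2 ▸ hKk, h3 ▸ hobj _ hob⟩) 0
      exact hnr k hgk
    · obtain ⟨k, hk, hgk⟩ := hfair (.step c) (hKinf c (hcorr c hc)) t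
      exact ⟨L + k, by omega, by rw [(hr' k).2, hgk]⟩
  obtain ⟨t', ht', c', hlt⟩ := hA r hF L c (hcorr' c hc) (by
    have := (hr' 0).1
    rw [Nat.add_zero] at this
    rwa [this])
  obtain ⟨k, rfl⟩ := Nat.exists_eq_add_of_le ht'
  refine ⟨k, c', ?_⟩
  rw [(hr' k).1] at hlt
  rwa [← Nat.add_zero L, (hr' 0).1] at hlt

/-! ### Changing crashes and written values -/

namespace Config

/-- The same configuration with other crashed components. -/
def setCrash (C : Finset P) (B : Finset (Fin n)) (s : Config A) : Config A :=
  { s with crashedClients := C, crashedObjects := B }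

/-- Transitions other than crashes never consult the crash sets. So crashes can be inserted in
retrospect, once it is known which clients and objects the schedule neglects. -/
theorem Guard.next_setCrash {s : Config A} {K : P → Prop} {B' : Finset (Fin n)}
    {a : Action n P V} (ha : s.Guard K B' a) (C : Finset P) (B : Finset (Fin n)) :
    (s.setCrash C B).next a = (s.next a).setCrash C B := by
  have hmove : ∀ (c : P) {R : Type v} (g : R → Option V)
      (y : A.Ctl × Finset (Bit P V) × Move n P V A.Req R),
      (s.setCrash C B).afterMove c g y = (s.afterMove c g y).setCrash C B := by
    rintro c R g ⟨y1, y2, _ | _ | _⟩ <;> rfl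
  cases a with
  | step c =>
    simp only [next]
    change (match s.kind (c, s.seq c) with
      | none => s.setCrash C B
      | some .read => (s.setCrash C B).afterMove c some _
      | some (.write _) => (s.setCrash C B).afterMove c (fun _ => none) _) = _
    rcases s.kind (c, s.seq c) with _ | _ | x
    · rfl
    · exact hmove ..
    · exact hmove ..
  | effect i =>
    obtain ⟨p, hp, -⟩ := ha
    have hp' : (s.setCrash C B).rmws i = some p := hp
    rw [next_effect hp, next_effect hp']; rfl
  | respond i =>
    obtain ⟨p, hp, ho, -⟩ := ha
    obtain ⟨y, hy⟩ := Option.ne_none_iff_exists'.1 ho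
    have hp' : (s.setCrash C B).rmws i = some p := hp
    rw [next_respond hp hy, next_respond hp' hy]; rfl
  | _ => exact ha.elim

/-- All crashes that the model permits may occur. -/
theorem reach_setCrash {s : Config A} (hC : s.crashedClients = ∅) (hB : s.crashedObjects = ∅)
    (C : Finset P) {B : Finset (Fin n)} (hcard : B.card ≤ f) : Reach f s (s.setCrash C B) := by
  have h1 : Reach f s (s.setCrash C ∅) := by
    induction C using Finset.induction with
    | empty =>
      have : s.setCrash ∅ ∅ = s := by
        cases s; simp_all [setCrash]
      rw [this]; exact .refl
    | insert c C hc ih => exact ih.step (a := .crashClient c) hc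
  induction B using Finset.induction with
  | empty => exact h1
  | insert b B hb ih =>
    rw [Finset.card_insert_of_notMem hb] at hcard
    exact (ih (by omega)).step (a := .crashObject b) ⟨hb, show B.card < f by omega⟩

/-- The same configuration, where the writes of each client `c` write `a c`. -/
def setVals (a : P → V) (s : Config A) : Config A :=
  { s with
    kind := fun o => (s.kind o).map fun k => match k with
      | .read => .read
      | .write _ => .write (a o.1) }

theorem setVals_kind (a : P → V) (s : Config A) (o : OpId P) :
    (s.setVals a).kind o = (s.kind o).map fun k => match k with
      | .read => .read
      | .write _ => .write (a o.1) := rfl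

theorem setVals_setVals (a b : P → V) (s : Config A) :
    (s.setVals b).setVals a = s.setVals a := by
  have : ((s.setVals b).setVals a).kind = (s.setVals a).kind := by
    funext o
    simp only [setVals_kind]
    rcases s.kind o with _ | _ | x <;> rfl
  change ({ s with kind := ((s.setVals b).setVals a).kind } : Config A) = _
  rw [this]; rfl

theorem setVals_kind_eq_none {a : P → V} {s : Config A} {o : OpId P} :
    (s.setVals a).kind o = none ↔ s.kind o = none := by
  simp [setVals_kind]

theorem setVals_kind_eq_write {a : P → V} {s : Config A} {o : OpId P} {x : V} :
    (s.setVals a).kind o = some (.write x) ↔ s.IsWrite o ∧ x = a o.1 := by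
  simp only [setVals_kind, IsWrite]
  rcases s.kind o with _ | _ | x <;> simp [eq_comm]

theorem setVals_isWrite {a : P → V} {s : Config A} {o : OpId P} :
    (s.setVals a).IsWrite o ↔ s.IsWrite o := by
  change (∃ x, (s.setVals a).kind o = some (.write x)) ↔ _
  simp [setVals_kind_eq_write]

theorem setVals_content {a : P → V} {s : Config A} {z : Bit P V} (h : s.IsWrite z.op) :
    (s.setVals a).content z = z.val (a z.op.1) := by
  obtain ⟨x, hx⟩ := h
  simp [content, setVals_kind, hx]

theorem setVals_content_of_not {a : P → V} {s : Config A} {z : Bit P V} (h : ¬ s.IsWrite z.op) :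
    (s.setVals a).content z = false := by
  simp only [content, setVals_kind]
  rcases hx : s.kind z.op with _ | _ | x
  · simp
  · simp
  · exact absurd ⟨x, hx⟩ h

theorem Guard.setVals {s : Config A} {K : P → Prop} {B : Finset (Fin n)} {a : Action n P V}
    (ha : s.Guard K B a) (x : P → V) : (s.setVals x).Guard K B a := by
  cases a <;> exact ha

theorem guard_setCrash {s : Config A} {K : P → Prop} {B' : Finset (Fin n)} {a : Action n P V}
    {C : Finset P} {B : Finset (Fin n)} :
    (s.setCrash C B).Guard K B' a ↔ s.Guard K B' a := by
  cases a <;> exact Iff.rfl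

/-- Written values influence a run only through the bits that a read sees. -/
theorem Guard.next_setVals {s : Config A} {K : P → Prop} {B : Finset (Fin n)}
    {a : Action n P V} (ha : s.Guard K B a) (x : P → V)
    (hread : ∀ c, a = .step c → s.kind (c, s.seq c) = some .read → ∀ z ∈ s.mem c,
      (s.setVals x).content z = s.content z) :
    (s.setVals x).next a = (s.next a).setVals x := by
  have hmove : ∀ (c : P) {R : Type v} (g : R → Option V)
      (y : A.Ctl × Finset (Bit P V) × Move n P V A.Req R),
      (s.setVals x).afterMove c g y = (s.afterMove c g y).setVals x := by
    rintro c R g ⟨y1, y2, _ | _ | _⟩ <;> rfl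
  cases a with
  | step c =>
    have hk : (s.setVals x).kind (c, (s.setVals x).seq c) = (s.kind (c, s.seq c)).map _ :=
      setVals_kind x s _
    rcases h : s.kind (c, s.seq c) with _ | _ | y
    · simp only [next, hk, h, Option.map_none]
    · have hc : (fun z : {z // z ∈ s.mem c} => (s.setVals x).content z.1) =
          fun z => s.content z.1 := funext fun z => hread c rfl h z.1 z.2
      simp only [next, hk, h, Option.map_some]
      rw [hmove]
      exact congrArg (fun y => (s.afterMove c some
        (A.readStep (c, s.seq c) (s.ctl c) (s.mem c) y)).setVals x) hc
    · simp only [next, hk, h, Option.map_some]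
      exact hmove ..
  | effect i =>
    obtain ⟨p, hp, -⟩ := ha
    have hp' : (s.setVals x).rmws i = some p := hp
    rw [next_effect hp, next_effect hp']; rfl
  | respond i =>
    obtain ⟨p, hp, ho, -⟩ := ha
    obtain ⟨y, hy⟩ := Option.ne_none_iff_exists'.1 ho
    have hp' : (s.setVals x).rmws i = some p := hp
    rw [next_respond hp hy, next_respond hp' hy]; rfl
  | _ => exact ha.elim

end Config

/-! ### A solitary reader cannot tell ambiguous values apart -/

/-- A read that runs alone, after some write returned, returns a written value; so the bits that it
can access must allow it to recover the value of some write. -/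
theorem not_weaklyRegular_of_ambiguous [Finite P] [Finite V] {v₀ : V} (hW : WeaklyRegular A f v₀)
    (hL : LockFree A f) {s : Config A}
    (hreach : ∀ a, Config.Reach f (Config.init A) (s.setVals a))
    (hC : s.crashedClients = ∅) (hB : s.crashedObjects = ∅)
    {F : Finset (Fin n)} (hF : F.card ≤ f)
    {rd : P} (hrd : ∀ k, s.kind (rd, k) = none) (hseq : s.seq rd = 0)
    {x x' : P → V} (hx : ∀ p, x p ≠ x' p)
    (hmem : ∀ z : Bit P V, s.Holds rd z → s.IsWrite z.op → z.val (x z.op.1) = z.val (x' z.op.1))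
    (hstore : ∀ b ∉ F, ∀ z ∈ s.store b, s.IsWrite z.op → z.val (x z.op.1) = z.val (x' z.op.1))
    {o : OpId P} (ho : s.IsWrite o) (hret : s.Returned o) : False := by
  have := Fintype.ofFinite P
  let C : Finset P := Finset.univ.erase rd
  have hCrd : rd ∉ C := Finset.notMem_erase _ _
  -- the configuration in which the read starts
  let st : (P → V) → Config A := fun a => ((s.setVals a).setCrash C F).next (.invokeRead rd)
  have hbusy₀ : ∀ a, ¬ ((s.setVals a).setCrash C F).Busy rd := fun a h =>
    h (Config.setVals_kind_eq_none.2 (hrd _))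
  have hst : ∀ a, Config.Reach f (s.setVals a) (st a) := fun a =>
    (Config.reach_setCrash (s := s.setVals a) hC hB C hF).step (a := .invokeRead rd)
      ⟨hCrd, hbusy₀ a⟩
  have hkind : ∀ a, (st a).kind = Function.update (s.setVals a).kind (rd, 0) (some .read) := by
    intro a
    rw [← hseq]; rfl
  have hw : ∀ a o, (st a).IsWrite o ↔ s.IsWrite o := by
    intro a o
    rw [← Config.setVals_isWrite (a := a) (s := s)]
    unfold Config.IsWrite
    rw [hkind]
    by_cases h : o = (rd, 0)
    · subst h; simp [Config.setVals_kind_eq_none.2 (hrd 0)]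
    · rw [Function.update_of_ne h]
  have hvals : ∀ a, (st x).setVals a = st a := by
    intro a
    have : ((st x).setVals a).kind = (st a).kind := by
      funext o
      rw [Config.setVals_kind, hkind, hkind]
      by_cases h : o = (rd, 0)
      · subst h; simp
      · rw [Function.update_of_ne h, Function.update_of_ne h, ← Config.setVals_kind,
          Config.setVals_setVals]
    change ({ st a with kind := ((st x).setVals a).kind } : Config A) = _
    rw [this]
  -- the invariant of the run of the reader
  let good : Bit P V → Prop := fun z => s.IsWrite z.op → z.val (x z.op.1) = z.val (x' z.op.1)
  have hdet : ∀ (M : Finset (Bit P V)) z, (∀ y ∈ M, good y) → Determined M z → good z :=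
    fun M z hM hz hzw => hz _ _ fun y hy hyz => by
      have := hM y hy (hyz ▸ hzw)
      rwa [hyz] at this
  let J : Config A → Prop := fun s' => s'.kind = (st x).kind ∧
    (∀ c, c ≠ rd → s'.seq c = (st x).seq c) ∧
    -- The reader invokes only operation `0`, so it returns at most once, and then with a recorded
    -- value.
    (s'.seq rd = 0 ∨ s'.seq rd = 1 ∧ ∃ y, s'.res (rd, 0) = some y) ∧
    (∀ z, s'.Holds rd z → good z) ∧ (∀ b ∉ F, ∀ z ∈ s'.store b, good z)
  have hkrd : ∀ k, (st x).kind (rd, k) = if k = 0 then some .read else none := by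
    intro k
    rw [hkind]
    by_cases h : k = 0
    · subst h; simp
    · rw [Function.update_of_ne (by simp [h]), if_neg h]
      exact Config.setVals_kind_eq_none.2 (hrd k)
  obtain ⟨σ, g, hσ₀, hσ, hJ, hG, hfair⟩ := exists_stronglyFair Config.next
    (fun s' a => s'.Guard (· = rd) F a) J (fun s' _ => ⟨.step rd, rfl⟩) (by
      rintro s' a ⟨hk, hs, hr, hm, hst⟩ ha
      refine ⟨ha.next_kind.trans hk, ?_, ?_, ?_⟩
      · intro c hc
        rcases ha.next_seq with ⟨h, -⟩ | ⟨d, -, rfl, -, h, -⟩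
        · rw [h]; exact hs c hc
        · rw [h, Function.update_of_ne hc]; exact hs c hc
      · rcases ha.next_seq with ⟨h, h'⟩ | ⟨d, -, rfl, hb, h, h'⟩
        · rw [h, h']; exact hr
        · rcases hr with hr | ⟨hr, -⟩
          · rw [hr] at h h'
            exact .inr ⟨by rw [h]; simp, h' (by rw [hk, hkrd]; rfl)⟩
          · refine absurd ?_ hb
            rw [hr, hk, hkrd]; rfl
      · have := ha.next_clean (C := {rd}) (D := {b | b ∉ F}) hdet
          (by rintro c rfl; exact hm) hst
          (by
            rintro c rfl ⟨y, hy⟩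
            rw [hk, hkrd] at hy
            split at hy <;> simp at hy)
          (by
            rintro i p rfl hp
            obtain ⟨q, hq, -, hq1, hq2⟩ := ha
            obtain rfl : p = q := by simpa [hp] using hq
            simp [hq1, hq2])
        exact ⟨this.1 rd rfl, this.2⟩)
    (st x) ⟨rfl, fun _ _ => rfl, .inl hseq, hmem, hstore⟩
  have hnC : ∀ c ∉ (σ 0).crashedClients, c = rd := by
    intro c hc
    rw [hσ₀] at hc
    by_contra h
    exact hc (Finset.mem_erase.2 ⟨h, Finset.mem_univ _⟩)
  have hrdC : rd ∉ (σ 0).crashedClients := by rw [hσ₀]; exact hCrd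
  obtain ⟨t, c, htc⟩ := hL.exists_return (σ := σ) (g := g)
    (by rw [hσ₀]; exact (hreach x).trans (hst x)) hσ (K := fun _ c => c = rd) (B := F)
    (by rw [hσ₀]; rfl) hG (by rintro t c rfl; exact hrdC)
    (fun c hc T => ⟨T, le_rfl, hnC c hc⟩) hfair hrdC (by
      rw [hσ₀]
      change (st x).kind (rd, s.seq rd) ≠ none
      rw [hkrd, hseq]; simp)
  have hc : c = rd := by
    by_contra hc
    rw [hσ₀, (hJ t).2.1 c hc] at htc
    exact lt_irrefl _ htc
  subst hc
  obtain ⟨y, hy⟩ : ∃ y, (σ t).res (c, 0) = some y := by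
    rcases (hJ t).2.2.1 with h | ⟨-, h⟩
    · omega
    · exact h
  -- Each client's value is `x p` or `x' p`, chosen to avoid `y`; possible since the two differ. The
  -- reader sees the same contents as under `x`.
  let a : P → V := fun p => if x p = y then x' p else x p
  have hay : ∀ p, a p ≠ y := by
    intro p
    by_cases h : x p = y
    · simp only [a, if_pos h]; rw [← h]; exact (hx p).symm
    · simpa only [a, if_neg h] using h
  have hax : ∀ p, a p = x p ∨ a p = x' p := by
    intro p
    by_cases h : x p = y
    · exact .inr (if_pos h)
    · exact .inl (if_neg h)
  -- The writes in `σ` already carry the values `x`, so contents in `σ t` can be computed by the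
  -- `setVals` lemmas.
  have hself : ∀ t, (σ t).setVals x = σ t := by
    intro t
    have h : ((σ t).setVals x).kind = (σ t).kind := by
      funext o
      rw [Config.setVals_kind, (hJ t).1, ← Config.setVals_kind, hvals]
    change ({ σ t with kind := ((σ t).setVals x).kind } : Config A) = _
    rw [h]
  -- The same actions replay with the values `a`, because all bits in the reader's memory are good.
  have hpath : ∀ t, Config.Reach f (st a) ((σ t).setVals a) := by
    intro t
    induction t with
    | zero => rw [hσ₀, hvals]; exact .refl
    | succ t ih =>
      have hcomm := (hG t).next_setVals a (by
        rintro d hd - z hz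
        have hdc : d = c := by
          have := hG t
          rw [hd] at this
          exact this
        subst hdc
        have hgood := (hJ t).2.2.2.1 z (.inl hz)
        by_cases hzw : (σ t).IsWrite z.op
        · rw [← congrArg (Config.content · z) (hself t)]
          simp only [Config.setVals_content hzw]
          have h := hgood ((hw x _).1 (by
            obtain ⟨v, hv⟩ := hzw
            exact ⟨v, (hJ t).1 ▸ hv⟩))
          rcases hax z.op.1 with h' | h' <;> rw [h']
          exact h.symm
        · rw [← congrArg (Config.content · z) (hself t)]
          simp only [Config.setVals_content_of_not hzw])
      rw [hσ, ← hcomm]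
      refine ih.step (((hG t).setVals a).enabled ?_ ?_)
      · rintro d rfl
        change d ∉ (σ t).crashedClients
        have : ∀ t, (σ t).crashedClients = (σ 0).crashedClients := fun t => by
          induction t with
          | zero => rfl
          | succ t ih => rw [hσ, (hG t).next_crashedClients, ih]
        rw [this]; exact hrdC
      · have : ∀ t, (σ t).crashedObjects = F := fun t => by
          induction t with
          | zero => rw [hσ₀]; rfl
          | succ t ih => rw [hσ, (hG t).next_crashedObjects, ih]
        exact (this t).subset
  obtain ⟨r₁, L, hL₁, hr₁⟩ := Run.exists_of_reach (hreach a)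
  obtain ⟨r, L', hlen, hLL, hr, hr'⟩ := r₁.exists_append (s := (σ t).setVals a) hL₁ (by
    rw [hr₁]; exact (hst a).trans (hpath t))
  have hcL : r.cfg L = s.setVals a := (hr L le_rfl).trans hr₁
  have hLl : (L : ℕ∞) ≤ r.len := by rw [hlen]; exact_mod_cast hLL
  have hwo : r.WritesValue o (a o.1) :=
    ⟨L, hLl, by rw [hcL]; exact Config.setVals_kind_eq_write.2 ⟨ho, rfl⟩⟩
  obtain ⟨W, pos, -, hWret, -, hprec, hlin⟩ := hW r (c, 0) y
    ⟨L', hlen.ge, by rw [hr']; exact hy⟩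
  have hoW : o ∈ W := hWret o _ hwo ⟨L, hLl, by rw [hcL]; exact hret⟩
  have hlt := hprec o (.inr hoW) (c, 0) (.inl rfl) ⟨L, hLl, by rw [hcL]; exact hret, by
    rw [hcL]
    exact fun h => h (Config.setVals_kind_eq_none.2 (hrd 0))⟩
  -- No write in this run has value `y`, and returning the initial value is excluded because `o`
  -- returned before the read was invoked.
  rcases hlin with ⟨o', -, ⟨t₀, ht₀, ho'⟩, -⟩ | ⟨-, hlin⟩
  · have h := r.kind_persist (t' := L') (by rw [hlen] at ht₀; exact_mod_cast ht₀) hlen.ge ho'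
    rw [hr', Config.setVals_kind_eq_write] at h
    exact hay _ h.2.symm
  · exact lt_asymm hlt (hlin o hoW)

/-! ### Pigeonhole and the write phase -/

/-- Fewer than `log₂ |V|` bits do not determine a value. -/
theorem exists_ne_forall_val_eq [Fintype V] (M : Finset (Bit P V))
    (hM : (M.card : ℝ) < Real.logb 2 (Fintype.card V)) :
    ∃ x x' : V, x ≠ x' ∧ ∀ z ∈ M, z.val x = z.val x' := by
  -- `Real.logb 2 0 = 0` by convention, so `hM` excludes an empty `V`.
  have hV : 0 < Fintype.card V := by
    by_contra h
    rw [Nat.eq_zero_of_not_pos h] at hM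
    simp only [Nat.cast_zero, Real.logb_zero] at hM
    exact absurd hM (not_lt.2 (Nat.cast_nonneg _))
  have hlt : 2 ^ M.card < Fintype.card V := by
    rw [Real.lt_logb_iff_rpow_lt (by norm_num) (by exact_mod_cast hV)] at hM
    exact_mod_cast hM
  obtain ⟨x, x', hne, h⟩ := Fintype.exists_ne_map_eq_of_card_lt
    (fun (x : V) (z : M) => z.1.val x) (by simpa using hlt)
  exact ⟨x, x', hne, fun z hz => congrFun h ⟨z, hz⟩⟩

namespace Config

/-- No bit of the operation `o` is stored in a base object or held by a client other than the one
that executes `o`. -/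
def Absent (s : Config A) (o : OpId P) : Prop :=
  (∀ b, ∀ z ∈ s.store b, z.op ≠ o) ∧ ∀ c ≠ o.1, ∀ z, s.Holds c z → z.op ≠ o

theorem FreshOK.mem_foreignBits {s : Config A} (hs : s.FreshOK) {c : P} {z : Bit P V} :
    z ∈ s.foreignBits c ↔ s.Holds c z ∧ z.op.1 ≠ c := by
  simp only [foreignBits, Finset.mem_filter, Finset.mem_union, Finset.mem_biUnion,
    Finset.mem_range, Holds]
  refine and_congr_left fun _ => or_congr_right ?_
  constructor
  · rintro ⟨i, -, hz⟩
    rcases hi : s.rmws i with _ | p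
    · simp [hi] at hz
    · simp only [hi] at hz
      split at hz
      · exact ⟨i, p, hi, by assumption, hz⟩
      · simp at hz
  · rintro ⟨i, p, hi, hp, hz⟩
    exact ⟨i, hs.lt hi, by simpa [hi, hp] using hz⟩

/-- With little storage, one of many concurrent writes has left no trace. -/
theorem exists_absent [Fintype P] {s : Config A} (hs : s.FreshOK) {W : Finset P}
    (hW : ∀ c ∈ W, s.Writing c) (hcr : s.crashedClients = ∅)
    (hempty : ∀ c ∉ W, ∀ z, ¬ s.Holds c z) (hst : s.storage < W.card) :
    ∃ c ∈ W, s.Absent (c, 0) := by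
  by_contra! hno
  refine absurd hst (not_lt.2 ?_)
  -- Each write of `W` with a trace labels at least one charged bit. A foreign holder lies in `W` by
  -- `hempty`, so it is writing and its foreign bits are charged.
  have hsub : W ⊆ (Finset.univ.biUnion fun b => (s.store b).image fun z => z.op.1) ∪
      (Finset.univ.filter fun c => c ∉ s.crashedClients ∧ s.Writing c).biUnion fun c =>
        (s.foreignBits c).image fun z => z.op.1 := by
    intro c hc
    have h := hno c hc
    rw [Absent, not_and_or] at h
    push Not at h
    rcases h with ⟨b, z, hz, hzo⟩ | ⟨d, hd, z, hz, hzo⟩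
    · exact Finset.mem_union_left _ (Finset.mem_biUnion.2
        ⟨b, Finset.mem_univ _, Finset.mem_image.2 ⟨z, hz, by rw [hzo]⟩⟩)
    · have hdW : d ∈ W := by
        by_contra h
        exact hempty d h z hz
      exact Finset.mem_union_right _ (Finset.mem_biUnion.2 ⟨d, by simp [hcr, hW d hdW],
        Finset.mem_image.2 ⟨z, hs.mem_foreignBits.2 ⟨hz, by rw [hzo]; exact hd.symm⟩,
          by rw [hzo]⟩⟩)
  refine (Finset.card_le_card hsub).trans ((Finset.card_union_le _ _).trans
    (Nat.add_le_add ?_ ?_))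
  · exact Finset.card_biUnion_le.trans (Finset.sum_le_sum fun b _ => Finset.card_image_le)
  · exact Finset.card_biUnion_le.trans (Finset.sum_le_sum fun b _ => Finset.card_image_le)

theorem Guard.next_store {s : Config A} {K : P → Prop} {B : Finset (Fin n)}
    {a : Action n P V} (ha : s.Guard K B a) {b : Fin n} (hb : b ∈ B) :
    (s.next a).store b = s.store b := by
  cases a with
  | step c => rcases s.step_cases c with ⟨-, h'⟩ | ⟨-, h'⟩ | ⟨-, h'⟩ <;> rw [h'] <;> simp
  | effect i =>
    obtain ⟨p, hp, -, -, hpb⟩ := ha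
    rw [next_effect hp]
    exact Function.update_of_ne (by rintro rfl; exact hpb hb) ..
  | respond i =>
    rcases s.respond_cases i with h' | ⟨p, y, hp, hy⟩
    · rw [h']
    · rw [next_respond hp hy]
  | _ => exact ha.elim

/-- No RMW takes effect on a full object, so its contents are frozen and it stays full. -/
theorem Guard.full_subset_next [Fintype V] {s : Config A} {K : P → Prop} {a : Action n P V}
    (ha : s.Guard K s.full a) : s.full ⊆ (s.next a).full := by
  intro b hb
  have hst := ha.next_store hb
  rw [full, Finset.mem_filter] at hb ⊢
  obtain ⟨-, o, ho, h⟩ := hb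
  exact ⟨Finset.mem_univ _, o, by rwa [IsWrite, ha.next_kind], by rwa [hst]⟩

/-- The configurations in which exactly the clients in `W` have invoked an operation, their first
one, which is a write, and in which no write can be recovered from the base objects that are not
full and the other clients. -/
structure WritePhase [Fintype V] (f : ℕ) (W : Finset P) (s : Config A) : Prop where
  reach : Reach f (init A) s
  reach_setVals : ∀ a, Reach f (init A) (s.setVals a)
  isWrite : ∀ o, s.IsWrite o ↔ o.1 ∈ W ∧ o.2 = 0
  not_read : ∀ o, s.kind o ≠ some .read
  crashedClients : s.crashedClients = ∅
  crashedObjects : s.crashedObjects = ∅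
  fresh : s.FreshOK
  empty : ∀ c ∉ W, ∀ z, ¬ s.Holds c z
  ambiguous : ∀ c ∈ W, ∃ x x' : V, x ≠ x' ∧
    (∀ d ≠ c, ∀ z, s.Holds d z → z.op = (c, 0) → z.val x = z.val x') ∧
    ∀ b ∉ s.full, ∀ z ∈ s.store b, z.op = (c, 0) → z.val x = z.val x'

/-- The clients in `W` whose first operation has left no trace. -/
def Active (W : Finset P) (s : Config A) (c : P) : Prop := c ∈ W ∧ s.Absent (c, 0)

/-- The point is ambiguity of the write of `c`. If an RMW of `c` takes effect, `c` was traceless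
before, so afterwards its bits outside `c` sit on that single object and the pair is chosen anew.
Any other action only combines bits that already agree on the old pair. -/
theorem WritePhase.next [Fintype V] [Nontrivial V] {W : Finset P} {s : Config A}
    (hs : s.WritePhase f W) {a : Action n P V}
    (ha : s.Guard (s.Active W) s.full a) : (s.next a).WritePhase f W where
  reach := hs.reach.step (ha.enabled (by simp [hs.crashedClients]) (by simp [hs.crashedObjects]))
  reach_setVals x := by
    rw [← ha.next_setVals x fun c _ h => absurd h (hs.not_read _)]
    exact (hs.reach_setVals x).step ((ha.setVals x).enabled (B := s.full)
      (by simp [setVals, hs.crashedClients]) (by simp [setVals, hs.crashedObjects]))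
  isWrite o := by rw [← hs.isWrite, IsWrite, ha.next_kind, IsWrite]
  not_read o := by rw [ha.next_kind]; exact hs.not_read o
  crashedClients := ha.next_crashedClients.trans hs.crashedClients
  crashedObjects := ha.next_crashedObjects.trans hs.crashedObjects
  fresh := hs.fresh.next a
  empty c hc z hz := hs.empty c hc z (ha.holds_of_next (fun h => hc h.1) hz)
  ambiguous c hc := by
    by_cases heff : ∃ i p, a = .effect i ∧ s.rmws i = some p ∧ p.client = c
    · obtain ⟨i, p, rfl, hp, rfl⟩ := heff
      obtain ⟨q, hq, ho, hK, hb⟩ := ha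
      obtain rfl : p = q := by simpa [hp] using hq
      -- Narrowing the acting clients to `p.client` shows that nobody else acquires bits.
      have ha' : s.Guard (· = p.client) s.full (.effect i) := ⟨p, hp, ho, rfl, hb⟩
      have hothers : ∀ d ≠ p.client, ∀ z, (s.next (.effect i)).Holds d z → z.op ≠ (p.client, 0) :=
        fun d hd z hz => hK.2.2 d hd z (ha'.holds_of_next hd hz)
      have hstore : ∀ b ≠ p.obj, (s.next (.effect i)).store b = s.store b := fun b hb => by
        rw [next_effect hp]; exact Function.update_of_ne hb ..
      have key : ∃ x x' : V, x ≠ x' ∧ (p.obj ∉ (s.next (.effect i)).full →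
          ∀ z ∈ (s.next (.effect i)).store p.obj, z.op = (p.client, 0) → z.val x = z.val x') := by
        by_cases hfull : p.obj ∈ (s.next (.effect i)).full
        · obtain ⟨x, x', hx⟩ := exists_pair_ne V
          exact ⟨x, x', hx, fun h => absurd hfull h⟩
        · have hlt : ((((s.next (.effect i)).store p.obj).filter
              fun z => z.op = (p.client, 0)).card : ℝ) < Real.logb 2 (Fintype.card V) := by
            refine not_le.1 fun h => hfull ?_
            refine Finset.mem_filter.2 ⟨Finset.mem_univ _, (p.client, 0), ?_, h⟩
            rw [IsWrite, ha'.next_kind]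
            exact (hs.isWrite _).2 ⟨hc, rfl⟩
          obtain ⟨x, x', hx, h⟩ := exists_ne_forall_val_eq _ hlt
          exact ⟨x, x', hx, fun _ z hz hzo => h z (Finset.mem_filter.2 ⟨hz, hzo⟩)⟩
      obtain ⟨x, x', hx, h⟩ := key
      refine ⟨x, x', hx, fun d hd z hz hzo => absurd hzo (hothers d hd z hz),
        fun b hb z hz hzo => ?_⟩
      by_cases hbp : b = p.obj
      · subst hbp; exact h hb z hz hzo
      · rw [hstore b hbp] at hz
        exact absurd hzo (hK.2.1 b z hz)
    · obtain ⟨x, x', hx, hh, hst⟩ := hs.ambiguous c hc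
      have := ha.next_clean (C := {d | d ≠ c}) (D := {b | b ∉ s.full})
        (g := fun z => z.op = (c, 0) → z.val x = z.val x')
        (fun M z hM hz hzo => hz _ _ fun y hy hyz => hM y hy (hyz.trans hzo))
        hh hst
        (fun d hd _ z hz hzo => absurd (congrArg Prod.fst (hz.symm.trans hzo)) hd)
        (fun i p hi hp => by
          subst hi
          obtain ⟨q, hq, -, -, hb⟩ := ha
          obtain rfl : p = q := by simpa [hp] using hq
          exact iff_of_true (fun h => heff ⟨i, p, rfl, hp, h⟩) hb)
      exact ⟨x, x', hx, this.1, fun b hb => this.2 b fun h => hb (ha.full_subset_next h)⟩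

/-- The clients in `W` can all invoke a write. -/
theorem exists_reach_invoked (A : Algorithm.{u, v, w} n P V) (f : ℕ) (v₀ : V) (W : Finset P) :
    ∃ s : Config A, Reach f (init A) s ∧ (∀ a, Reach f (init A) (s.setVals a)) ∧
      s.kind = (fun o => if o.1 ∈ W ∧ o.2 = 0 then some (.write v₀) else none) ∧
      s.crashedClients = ∅ ∧ s.crashedObjects = ∅ ∧ s.rmws = (fun _ => none) ∧
      s.mem = (fun _ => ∅) ∧ s.store = (fun _ => ∅) ∧ s.seq = fun _ => 0 := by
  induction W using Finset.induction with
  | empty =>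
    exact ⟨init A, .refl, fun a => .refl, by funext o; simp [init], rfl, rfl, rfl, rfl, rfl, rfl⟩
  | insert c W hc ih =>
    obtain ⟨s, h1, h2, hk, h3, h4, h5, h6, h7, h8⟩ := ih
    have hkc : s.kind (c, s.seq c) = none := by simp [hk, hc]
    refine ⟨s.next (.invokeWrite c v₀), h1.step ⟨by simp [h3], fun h => h hkc⟩, fun a => ?_, ?_,
      h3, h4, h5, h6, h7, h8⟩
    -- Changing the values afterwards amounts to invoking the write with `a c` instead of `v₀`.
    · have : (s.next (.invokeWrite c v₀)).setVals a =
          (s.setVals a).next (.invokeWrite c (a c)) := by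
        have hkind : ((s.next (.invokeWrite c v₀)).setVals a).kind =
            ((s.setVals a).next (.invokeWrite c (a c))).kind := by
          funext o
          rw [setVals_kind]
          change (Function.update s.kind (c, s.seq c) _ o).map _ =
            Function.update (s.setVals a).kind (c, s.seq c) _ o
          by_cases h : o = (c, s.seq c)
          · subst h; simp
          · rw [Function.update_of_ne h, Function.update_of_ne h, setVals_kind]
        change ({ (s.setVals a).next (.invokeWrite c (a c)) with
          kind := ((s.next (.invokeWrite c v₀)).setVals a).kind } : Config A) = _
        rw [hkind]
      rw [this]
      exact (h2 a).step ⟨by simp [setVals, h3], fun h => h (setVals_kind_eq_none.2 hkc)⟩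
    · change Function.update s.kind (c, s.seq c) _ = _
      funext ⟨d, k⟩
      rw [hk, h8]
      by_cases hd : d = c
      · subst hd
        by_cases hk0 : k = 0
        · subst hk0; simp
        · rw [Function.update_of_ne (by simp [hk0])]; simp [hk0]
      · rw [Function.update_of_ne (by simp [hd])]; simp [hd]

end Config

/-! ### The two contradictory claims about returning writes -/

open Config

/-- In the write phase no write returns. -/
theorem Config.WritePhase.seq_next [Fintype V] [Nontrivial V] [Finite P] {v₀ : V}
    (hreg : WeaklyRegular A f v₀) (hlf : LockFree A f)
    (hfull : ∀ s : Config A, Reach f (init A) s → s.full.card ≤ f)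
    {W : Finset P} {rd : P} (hrd : rd ∉ W) {s : Config A}
    (hs : s.WritePhase f W) (hseq : ∀ c, s.seq c = 0) {a : Action n P V}
    (ha : s.Guard (s.Active W) s.full a) (c : P) : (s.next a).seq c = 0 := by
  rcases ha.next_seq with ⟨h, -⟩ | ⟨d, -, hd, -, h, -⟩
  · rw [h, hseq]
  · exfalso
    have hs' := hs.next ha
    -- Clients outside `W` write nothing; any two distinct values serve for them.
    have hpair : ∀ p, ∃ x x' : V, x ≠ x' ∧ (p ∈ W → ∀ b ∉ (s.next a).full,
        ∀ z ∈ (s.next a).store b, z.op = (p, 0) → z.val x = z.val x') := by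
      intro p
      by_cases hp : p ∈ W
      · obtain ⟨x, x', hx, -, h⟩ := hs'.ambiguous p hp
        exact ⟨x, x', hx, fun _ => h⟩
      · obtain ⟨x, x', hx⟩ := exists_pair_ne V
        exact ⟨x, x', hx, fun h => absurd h hp⟩
    choose x x' hx hxx using hpair
    have hrdd : rd ≠ d := by rintro rfl; exact hrd hd.1
    refine not_weaklyRegular_of_ambiguous hreg hlf hs'.reach_setVals hs'.crashedClients
      hs'.crashedObjects (hfull _ hs'.reach) (rd := rd) ?_ ?_ hx
      (fun z hz => absurd hz (hs'.empty rd hrd z)) ?_ ((hs'.isWrite (d, 0)).2 ⟨hd.1, rfl⟩) ?_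
    · intro k
      rcases hk : (s.next a).kind (rd, k) with _ | _ | y
      · rfl
      · exact absurd hk (hs'.not_read _)
      · exact absurd ((hs'.isWrite _).1 ⟨y, hk⟩).1 hrd
    · rw [h, Function.update_of_ne hrdd, hseq]
    · intro b hb z hz hzw
      obtain ⟨h1, h2⟩ := (hs'.isWrite _).1 hzw
      exact hxx _ h1 b hb z hz (Prod.ext rfl h2)
    · change 0 < (s.next a).seq d
      rw [h]; simp

/-- Some write returns in the write phase. -/
theorem not_lockFree_of_seq_next [Fintype V] [Nontrivial V] [Fintype P] (hlf : LockFree A f)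
    {W : Finset P}
    (hbound : ∀ s : Config A, Reach f (init A) s → s.storage < W.card ∧ s.full.card ≤ f)
    (hret : ∀ (s : Config A) (a : Action n P V), s.WritePhase f W → (∀ c, s.seq c = 0) →
      s.Guard (s.Active W) s.full a → ∀ c, (s.next a).seq c = 0)
    {s₀ : Config A} (hs₀ : s₀.WritePhase f W) (hseq₀ : ∀ c, s₀.seq c = 0) : False := by
  have hactive : ∀ s : Config A, s.WritePhase f W → (∀ c, s.seq c = 0) → ∃ c, s.Active W c := by
    intro s hs hseq
    obtain ⟨c, hc, hc'⟩ := exists_absent hs.fresh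
      (fun c hc => (hs.isWrite _).2 ⟨hc, hseq c⟩) hs.crashedClients hs.empty
      (hbound s hs.reach).1
    exact ⟨c, hc, hc'⟩
  obtain ⟨σ, g, -, hσ, hJ, hG, hfair⟩ := exists_stronglyFair Config.next
    (fun (s : Config A) a => s.Guard (s.Active W) s.full a)
    (fun s => s.WritePhase f W ∧ ∀ c, s.seq c = 0)
    (fun s hs => by
      obtain ⟨c, hc⟩ := hactive s hs.1 hs.2
      exact ⟨.step c, hc⟩)
    (fun s a hs ha => ⟨hs.1.next ha, hret s a hs.1 hs.2 ha⟩) s₀ ⟨hs₀, hseq₀⟩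
  obtain ⟨T₁, hT₁⟩ := WellFoundedGT.monotone_chain_condition
    (⟨fun t => (σ t).full, monotone_nat_of_le_succ fun t => by
      rw [hσ]; exact (hG t).full_subset_next⟩ : ℕ →o Finset (Fin n))
  -- For a client that is active only finitely often, `T` is a time after its last activity; for the
  -- others any `T` works.
  have hT : ∀ c, ∃ T, (∃ t ≥ T, (σ t).Active W c) → ∀ T, ∃ t ≥ T, (σ t).Active W c := by
    intro c
    by_contra! h
    obtain ⟨-, T, hT⟩ := h 0
    obtain ⟨⟨t, ht, htc⟩, -⟩ := h T
    exact hT t ht htc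
  choose T₂ hT₂ using hT
  let T := max T₁ (Finset.univ.sup T₂)
  have hle : ∀ c, T₂ c ≤ T := fun c =>
    (Finset.le_sup (Finset.mem_univ c)).trans (le_max_right _ _)
  have hF : ∀ t, (σ (T + t)).full = (σ T₁).full := fun t =>
    (hT₁ (T + t) ((le_max_left _ _).trans (Nat.le_add_right _ _))).symm
  -- The clients to be crashed: those that are not active infinitely often, hence never after `T`.
  let C : Finset P := Finset.univ.filter fun c => ¬ ∀ T, ∃ t ≥ T, (σ t).Active W c
  have hC : ∀ {c}, c ∉ C ↔ ∀ T, ∃ t ≥ T, (σ t).Active W c := fun {c} => by simp [C]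
  have hCact : ∀ t c, (σ (T + t)).Active W c → c ∉ C := fun t c h =>
    hC.2 (hT₂ c ⟨T + t, (hle c).trans (Nat.le_add_right _ _), h⟩)
  obtain ⟨c, hc⟩ := hactive (σ T) (hJ T).1 (hJ T).2
  have hcC : c ∉ C := hCact 0 c hc
  -- The crashes are inserted at time `T`, when the set of full objects has stabilized; the tail of
  -- the schedule is then fair for the survivors.
  obtain ⟨t, c', h⟩ := hlf.exists_return
    (σ := fun t => (σ (T + t)).setCrash C (σ T₁).full) (g := fun t => g (T + t))
    ((hJ T).1.reach.trans (reach_setCrash (hJ T).1.crashedClients (hJ T).1.crashedObjects C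
      (hbound _ (hJ T₁).1.reach).2))
    (fun t => by
      rw [(hG (T + t)).next_setCrash, ← hσ]; rfl)
    (K := fun t => (σ (T + t)).Active W) (B := (σ T₁).full) rfl
    (fun t => guard_setCrash.2 (by rw [← hF t]; exact hG (T + t)))
    hCact
    (fun d hd T' => by
      obtain ⟨t, ht, htd⟩ := hC.1 hd (T + T')
      obtain ⟨k, rfl⟩ := Nat.exists_eq_add_of_le ((Nat.le_add_right _ _).trans ht)
      exact ⟨k, by omega, htd⟩)
    (fun a ha T' => by
      obtain ⟨t, ht, hta⟩ := hfair a (fun T'' => by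
        obtain ⟨t, ht, h⟩ := ha T''
        rw [guard_setCrash, ← hF t] at h
        exact ⟨T + t, by omega, h⟩) (T + T')
      obtain ⟨k, rfl⟩ := Nat.exists_eq_add_of_le ((Nat.le_add_right _ _).trans ht)
      exact ⟨k, by omega, hta⟩)
    hcC (by
      obtain ⟨x, hx⟩ := ((hJ T).1.isWrite (c, (σ T).seq c)).2 ⟨hc.1, (hJ T).2 c⟩
      change (σ T).kind (c, (σ T).seq c) ≠ none
      rw [hx]; simp)
  change (σ T).seq c' < (σ (T + t)).seq c' at h
  rw [(hJ T).2, (hJ (T + t)).2] at h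
  exact lt_irrefl _ h

end

end RegisterEmulation

/-! ### Setting up the writers and the reader -/

theorem mainTheorem1 {P V : Type*} [Fintype P] [Fintype V] (v₀ : V)
    (n f S : ℕ) (hf : 2 * f < n) (hS : S < Fintype.card P) :
    ¬ ∃ A : RegisterEmulation.Algorithm n P V,
      RegisterEmulation.WeaklyRegular A f v₀ ∧
      RegisterEmulation.LockFree A f ∧
      ∀ (r : RegisterEmulation.Run A f) (t : ℕ), (t : ℕ∞) ≤ r.len →
        (r.cfg t).storage < S ∧ (r.cfg t).full.card ≤ f := by
  classical
  rintro ⟨A, hreg, hlf, hbound⟩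
  have hb : ∀ s : RegisterEmulation.Config A,
      RegisterEmulation.Config.Reach f (RegisterEmulation.Config.init A) s →
      s.storage < S ∧ s.full.card ≤ f := by
    intro s hs
    obtain ⟨r, L, hL, rfl⟩ := RegisterEmulation.Run.exists_of_reach hs
    exact hbound r L hL.ge
  obtain ⟨W, -, rfl⟩ := Finset.exists_subset_card_eq (s := (Finset.univ : Finset P)) hS.le
  obtain ⟨s, h1, h2, hk, h3, h4, h5, h6, h7, h8⟩ :=
    RegisterEmulation.Config.exists_reach_invoked A f v₀ W
  have hw : ∀ o, s.IsWrite o ↔ o.1 ∈ W ∧ o.2 = 0 := fun o => by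
    simp only [RegisterEmulation.Config.IsWrite, hk]
    split <;> simp_all
  have hh : ∀ c z, ¬ s.Holds c z := by
    rintro c z (h | ⟨i, p, hi, -⟩)
    · simp [h6] at h
    · simp [h5] at hi
  -- If `|V| = 1` then `D = 0`, so a single invoked write makes all `n > f` objects full.
  have hV : Nontrivial V := by
    rw [← Fintype.one_lt_card_iff_nontrivial]
    by_contra hV
    have hcard : Fintype.card V = 1 := by
      have := Fintype.card_pos_iff.2 ⟨v₀⟩
      omega
    obtain ⟨c, hc⟩ := Finset.card_pos.1 ((Nat.zero_le _).trans_lt (hb s h1).1)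
    have huniv : s.full = Finset.univ := by
      refine Finset.eq_univ_of_forall fun b =>
        Finset.mem_filter.2 ⟨Finset.mem_univ _, (c, 0), (hw _).2 ⟨hc, rfl⟩, ?_⟩
      rw [hcard, Nat.cast_one, Real.logb_one]
      exact Nat.cast_nonneg _
    have := (hb s h1).2
    rw [huniv, Finset.card_univ, Fintype.card_fin] at this
    omega
  obtain ⟨rd, hrd⟩ : ∃ rd, rd ∉ W := by
    by_contra! h
    rw [Finset.eq_univ_of_forall h, Finset.card_univ] at hS
    exact lt_irrefl _ hS
  obtain ⟨x, x', hx⟩ := exists_pair_ne V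
  exact RegisterEmulation.not_lockFree_of_seq_next hlf hb
    (fun s a hs hseq ha =>
      RegisterEmulation.Config.WritePhase.seq_next hreg hlf (fun s hs => (hb s hs).2) hrd hs hseq ha)
    (s₀ := s)
    { reach := h1
      reach_setVals := h2
      isWrite := hw
      not_read := fun o => by rw [hk]; dsimp only; split <;> simp
      crashedClients := h3
      crashedObjects := h4
      fresh := fun i _ => by rw [h5]
      empty := fun c _ z => hh c z
      ambiguous := fun c _ => ⟨x, x', hx, fun d _ z hz => absurd hz (hh d z),
        fun b _ z hz => by simp [h7] at hz⟩ }
    (fun c => by rw [h8])
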